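/- Let $G=(V,E)$ be a finite simple graph with $n=|V|\ge 3$ vertices and $m=|E|\ge 1$ edges, let $p\in(0,1)^E$, $\lambda\in[0,1)^V$, and put $p_{\min}=\min_{e\in E}p_e$, $\lambda_{\max}=\max_{v\in V}\lambda_v$. The random cluster distribution $\mu$ on the subsets of $E$ is $$\mu(S)\ \propto\ \prod_{e\in S}p_e\prod_{f\in E\setminus S}(1-p_f)\prod_{C\in\kappa(V,S)}\Bigl(1+\prod_{j\in C}\lambda_j\Bigr),$$ where $\kappa(V,S)$ is the set of connected components of the graph $(V,S)$. The Glauber dynamics for $\mu$ is the Markov chain on the subsets of $E$ that, in state $X$, picks $e\in E$ uniformly at random and moves to a configuration drawn from $\mu$ conditioned on agreeing with $X$ on $E\setminus\{e\}$; let $P$ be its transition matrix. Let $\varepsilon\in(0,1)$ and suppose that $$(1-p_{\min})\log n\ \le\ \min\left\{10^{-5}\exp\left(-\frac{\log(8/\varepsilon)}{\log n}\right),\ \frac{1-\lambda_{\max}}{27}\right\}.$$ Then: 1. The mixing time of the Glauber dynamics started from the full edge set $E$, that is, $T(\varepsilon,E)=\min\{t\in\mathbb N : d_{\mathrm{TV}}(P^t(E,\cdot),\mu)<\varepsilon\}$,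 exists and satisfies $$T(\varepsilon,E)\le 2m\left(\log m+\log\frac{2}{\varepsilon}\right).$$ 2. For every integer $T\ge 2m(\log m+\log(2/\varepsilon))$ there is a coupling of the Glauber dynamics $(X_t)_{t\ge0}$ started from $X_0=E$ and the Glauber dynamics $(Y_t)_{t\ge0}$ started from $Y_0\sim\mu$ such that $\Pr[X_T\ne Y_T]\le\varepsilon$. -/

import Mathlib

open MeasureTheory

universe u

noncomputable section

namespace RandomCluster

section FiniteDistributions

variable {Ω : Type*} [Fintype Ω] [DecidableEq Ω]

/-- Total variation distance of two distributions on a finite set. -/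
def tvDist (μ ν : Ω → ℝ) : ℝ := (1 / 2) * ∑ x, |μ x - ν x|

/-- The distribution `μ` conditioned on the event `A`. -/
def condOn (μ : Ω → ℝ) (A : Finset Ω) (x : Ω) : ℝ :=
  if x ∈ A then μ x / ∑ y ∈ A, μ y else 0

/-- `T` is the mixing time of the chain with transition matrix `P`, stationary distribution `μ`
and initial state `x`: the least `t` such that `P ^ t (x, ·)` is at total variation distance
less than `ε` from `μ`. -/
def IsMixingTime (P : Matrix Ω Ω ℝ) (μ : Ω → ℝ) (ε : ℝ) (x : Ω) (T : ℕ) : Prop :=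
  IsLeast {t : ℕ | tvDist (fun y => (P ^ t) x y) μ < ε} T

end FiniteDistributions

/-- The process `X` on the probability space `(S, ℙ)` is a Markov chain on the finite set `Ω`
with initial distribution `ν` and transition matrix `P`
(expressed through its finite-dimensional distributions). -/
def IsMarkovChain {S : Type*} [MeasurableSpace S] (ℙ : Measure S) {Ω : Type*}
    (ν : Ω → ℝ) (P : Matrix Ω Ω ℝ) (X : ℕ → S → Ω) : Prop :=
  (∀ t x, MeasurableSet {s | X t s = x}) ∧
  ∀ (t : ℕ) (x : ℕ → Ω),
    ℙ {s | ∀ i ≤ t, X i s = x i} =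
      ENNReal.ofReal (ν (x 0) * ∏ i ∈ Finset.range t, P (x i) (x (i + 1)))

section Glauber

variable {U : Type*} [Fintype U] [DecidableEq U]

/-- The subsets of `U` that agree with `τ` on `Λ`. -/
def agreeing (τ Λ : Finset U) : Finset (Finset U) :=
  Finset.univ.filter fun S => S ∩ Λ = τ ∩ Λ

/-- Transition matrix of the Glauber dynamics of a distribution `μ` on the subsets of `U`: pick
`i ∈ U` uniformly at random and resample from `μ` conditioned on agreeing with the current
configuration off `i`. -/
def glauber (μ : Finset U → ℝ) : Matrix (Finset U) (Finset U) ℝ :=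
  fun X Y => (1 / (Fintype.card U : ℝ)) *
    ∑ i : U, condOn μ (agreeing X (Finset.univ \ {i})) Y

end Glauber

section Model

variable {V : Type u} [Fintype V] [DecidableEq V] (G : SimpleGraph V) [DecidableRel G.Adj]

/-- The spanning subgraph `(V, S)` of `G`. -/
def spanning (S : Finset G.edgeSet) : SimpleGraph V :=
  SimpleGraph.fromEdgeSet ((fun e : G.edgeSet => (e : Sym2 V)) '' (S : Set G.edgeSet))

open Classical in
/-- Weight of the configuration `S ⊆ E` in the random cluster model; the last product ranges over
the connected components of `(V, S)`. -/
def weight (p : G.edgeSet → ℝ) (lam : V → ℝ) (S : Finset G.edgeSet) : ℝ :=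
  (∏ e ∈ S, p e) * (∏ f ∈ Finset.univ \ S, (1 - p f)) *
    ∏ C : (spanning G S).ConnectedComponent, (1 + ∏ j ∈ C.supp.toFinset, lam j)

/-- The random cluster distribution on the subsets of `E`. -/
def rcDist (p : G.edgeSet → ℝ) (lam : V → ℝ) (S : Finset G.edgeSet) : ℝ :=
  weight G p lam S / ∑ T : Finset G.edgeSet, weight G p lam T

end Model

end RandomCluster

end

/-! The proof couples two copies of the dynamics monotonically: `X` starts from the full edge set,
`Y` from `μ`, both update the same edge, and `Y ⊆ X` is preserved because the heat-bath probability
`addProb` is monotone in the configuration. The quantity followed is the expected size of the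
discrepancy `X \ Y`, which dominates the probability that the copies differ and hence the total
variation distance.

In one step the discrepancy loses a fraction `1/m` and gains `1/m` times the total influence of `X \
Y` on the update probabilities. Adding the discrepant edges one at a time, it suffices that a single
edge `f = xy` has total influence at most `1/2` (`sum_addProb_insert_sub_le`). Adding `f` changes
the update at `e` only if `e` leaves the cluster of `x` or of `y` in `Z \ e`, and the change is then
at most `1 - p e` times the product of the fields over that cluster, one term for each end
(`ratio_sub_ratio_insert`). With `ρ` the maximal field, edges `e ∈ Z` that count are bridges, and
their weights sum to at most `1/(1-ρ)` (`sum_bridges_le`). Edges outside `Z` form the boundary of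
the cluster `A` of `x`; if this has at most `|A| log n` edges, they contribute at most `log
n/(1-ρ)`, since `k * ρ ^ k ≤ 1/(1-ρ)`.

The needed cut condition `SmallCuts` passes to supersets, so only `Y` has to satisfy it, and `Y` has
law `μ` at all times. A set `A` with a larger boundary is cut off with probability at most
`(3q)^(|A| log n)`, where `q = 1 - p_min`, and a union bound over `A` makes bad configurations rare
(`sum_rcDist_not_smallCuts_le`). Iterating (`expected_disc_le`) leaves a contracted initial
discrepancy plus `2m` times the bad probability, in total less than `ε`. -/

noncomputable section

namespace RandomCluster

set_option linter.unusedSectionVars false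

/-! ### Heat-bath updates and one step of the monotone coupling. -/

section SingleSite

variable {U : Type*} [DecidableEq U]

/-- The probability that the heat-bath update of `i` in state `X` puts `i` into the
configuration. -/
def addProb (μ : Finset U → ℝ) (X : Finset U) (i : U) : ℝ :=
  μ (insert i X) / (μ (insert i X) + μ (X.erase i))

lemma addProb_nonneg {μ : Finset U → ℝ} (hμ : ∀ S, 0 < μ S) (X : Finset U) (i : U) :
    0 ≤ addProb μ X i :=
  div_nonneg (hμ _).le (add_pos (hμ _) (hμ _)).le

lemma addProb_le_one {μ : Finset U → ℝ} (hμ : ∀ S, 0 < μ S) (X : Finset U) (i : U) :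
    addProb μ X i ≤ 1 :=
  (div_le_one (add_pos (hμ _) (hμ _))).2 (by linarith [hμ (X.erase i)])

lemma insert_ne_erase (X : Finset U) (i : U) : insert i X ≠ X.erase i := fun h => by
  have := h ▸ Finset.mem_insert_self i X
  simp at this

variable [Fintype U]

lemma agreeing_compl_singleton (X : Finset U) (i : U) :
    agreeing X (Finset.univ \ {i}) = {insert i X, X.erase i} := by
  ext S
  simp only [agreeing, Finset.mem_filter, Finset.mem_univ, true_and, Finset.mem_insert,
    Finset.mem_singleton]
  constructor
  · intro h
    have h' : ∀ j, j ≠ i → (j ∈ S ↔ j ∈ X) := fun j hj => by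
      have := Finset.ext_iff.1 h j
      simpa [hj] using this
    by_cases hi : i ∈ S
    · left; ext j; by_cases hj : j = i
      · subst hj; simp [hi]
      · simp [hj, h' j hj]
    · right; ext j; by_cases hj : j = i
      · subst hj; simp [hi]
      · simp [hj, h' j hj]
  · rintro (rfl | rfl) <;> ext j <;> by_cases hj : j = i <;> simp [hj]

lemma condOn_agreeing {μ : Finset U → ℝ} (hμ : ∀ S, 0 < μ S) (X Y : Finset U) (i : U) :
    condOn μ (agreeing X (Finset.univ \ {i})) Y =
      addProb μ X i * (if insert i X = Y then 1 else 0) +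
        (1 - addProb μ X i) * (if X.erase i = Y then 1 else 0) := by
  have hne := insert_ne_erase X i
  have hpos := add_pos (hμ (insert i X)) (hμ (X.erase i))
  rw [condOn, agreeing_compl_singleton, Finset.sum_pair hne]
  by_cases h1 : insert i X = Y
  · subst h1
    simp [hne.symm, addProb]
  · by_cases h2 : X.erase i = Y
    · subst h2
      simp only [Finset.mem_insert, Finset.mem_singleton, or_true, if_true, if_neg hne, mul_zero,
        mul_one, zero_add, addProb]
      field_simp
      ring
    · simp [h1, h2, Ne.symm h1, Ne.symm h2]

/-- One step of the monotone coupling of two heat-bath dynamics. -/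
def coupled (μ : Finset U → ℝ) : Matrix (Finset U × Finset U) (Finset U × Finset U) ℝ :=
  fun z w => (1 / (Fintype.card U : ℝ)) * ∑ i : U,
    -- One uniform threshold decides both copies. Writing the four outcomes with `min` and `max`
    -- gives nonnegative weights and the right marginals for every pair, ordered or not.
    (min (addProb μ z.1 i) (addProb μ z.2 i) *
        (if (insert i z.1, insert i z.2) = w then 1 else 0) +
      (addProb μ z.1 i - min (addProb μ z.1 i) (addProb μ z.2 i)) *
        (if (insert i z.1, z.2.erase i) = w then 1 else 0) +
      (addProb μ z.2 i - min (addProb μ z.1 i) (addProb μ z.2 i)) *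
        (if (z.1.erase i, insert i z.2) = w then 1 else 0) +
      (1 - max (addProb μ z.1 i) (addProb μ z.2 i)) *
        (if (z.1.erase i, z.2.erase i) = w then 1 else 0))

lemma coupled_nonneg {μ : Finset U → ℝ} (hμ : ∀ S, 0 < μ S) (z w : Finset U × Finset U) :
    0 ≤ coupled μ z w := by
  refine mul_nonneg (by positivity) (Finset.sum_nonneg fun i _ => ?_)
  have hite : ∀ (c : Prop) [Decidable c], (0 : ℝ) ≤ if c then 1 else 0 := fun c _ => by
    split_ifs <;> norm_num
  have h1 : 0 ≤ min (addProb μ z.1 i) (addProb μ z.2 i) :=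
    le_min (addProb_nonneg hμ _ _) (addProb_nonneg hμ _ _)
  have h2 := min_le_left (addProb μ z.1 i) (addProb μ z.2 i)
  have h3 := min_le_right (addProb μ z.1 i) (addProb μ z.2 i)
  have h4 : max (addProb μ z.1 i) (addProb μ z.2 i) ≤ 1 :=
    max_le (addProb_le_one hμ _ _) (addProb_le_one hμ _ _)
  refine add_nonneg (add_nonneg (add_nonneg ?_ ?_) ?_) ?_ <;>
    refine mul_nonneg ?_ (hite _) <;> linarith

lemma sum_coupled_mul (μ : Finset U → ℝ) (z : Finset U × Finset U)
    (g : Finset U × Finset U → ℝ) :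
    ∑ w, coupled μ z w * g w = (1 / (Fintype.card U : ℝ)) * ∑ i : U,
    (min (addProb μ z.1 i) (addProb μ z.2 i) * g (insert i z.1, insert i z.2) +
      (addProb μ z.1 i - min (addProb μ z.1 i) (addProb μ z.2 i)) * g (insert i z.1, z.2.erase i) +
      (addProb μ z.2 i - min (addProb μ z.1 i) (addProb μ z.2 i)) * g (z.1.erase i, insert i z.2) +
      (1 - max (addProb μ z.1 i) (addProb μ z.2 i)) * g (z.1.erase i, z.2.erase i)) := by
  have key : ∀ (c : ℝ) (v : Finset U × Finset U),
      ∑ w, c * (if v = w then 1 else 0) * g w = c * g v := fun c v => by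
    simp [ite_mul]
  simp only [coupled, mul_assoc, ← Finset.mul_sum, Finset.sum_mul]
  rw [Finset.sum_comm]
  congr 1
  refine Finset.sum_congr rfl fun i _ => ?_
  simp only [add_mul, Finset.sum_add_distrib, key]

lemma sum_coupled_fst {μ : Finset U → ℝ} (hμ : ∀ S, 0 < μ S) (z : Finset U × Finset U)
    (X : Finset U) : ∑ Y, coupled μ z (X, Y) = glauber μ z.1 X := by
  have h := sum_coupled_mul μ z fun w => if w.1 = X then 1 else 0
  rw [Fintype.sum_prod_type, Finset.sum_eq_single X] at h
  · simp only [if_true, mul_one] at h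
    rw [h, glauber]
    congr 1
    refine Finset.sum_congr rfl fun i _ => ?_
    rw [condOn_agreeing hμ]
    split_ifs <;> linarith [max_add_min (addProb μ z.1 i) (addProb μ z.2 i)]
  · intro b _ hb; simp [hb]
  · simp

lemma sum_coupled_snd {μ : Finset U → ℝ} (hμ : ∀ S, 0 < μ S) (z : Finset U × Finset U)
    (Y : Finset U) : ∑ X, coupled μ z (X, Y) = glauber μ z.2 Y := by
  have h := sum_coupled_mul μ z fun w => if w.2 = Y then 1 else 0
  rw [Fintype.sum_prod_type_right, Finset.sum_eq_single Y] at h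
  · simp only [if_true, mul_one] at h
    rw [h, glauber]
    congr 1
    refine Finset.sum_congr rfl fun i _ => ?_
    rw [condOn_agreeing hμ]
    split_ifs <;> linarith [max_add_min (addProb μ z.1 i) (addProb μ z.2 i)]
  · intro b _ hb; simp [hb]
  · simp

lemma glauber_row_sum [Nonempty U] {μ : Finset U → ℝ} (hμ : ∀ S, 0 < μ S) (X : Finset U) :
    ∑ Y, glauber μ X Y = 1 := by
  simp only [glauber, ← Finset.mul_sum]
  rw [Finset.sum_comm]
  simp [condOn_agreeing hμ, Finset.sum_add_distrib]

lemma coupled_row_sum [Nonempty U] {μ : Finset U → ℝ} (hμ : ∀ S, 0 < μ S)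
    (z : Finset U × Finset U) : ∑ w, coupled μ z w = 1 := by
  rw [Fintype.sum_prod_type]
  simp only [sum_coupled_fst hμ, glauber_row_sum hμ]

/-- Configurations that agree off `i` have the same fibre, so each summand is `μ X * μ Y` divided by
the mass of that fibre, which is symmetric. -/
lemma glauber_reversible (μ : Finset U → ℝ) (X Y : Finset U) :
    μ X * glauber μ X Y = μ Y * glauber μ Y X := by
  simp only [glauber, mul_left_comm (μ _)]
  congr 1
  simp only [Finset.mul_sum]
  refine Finset.sum_congr rfl fun i _ => ?_
  have hsymm : Y ∈ agreeing X (Finset.univ \ {i}) ↔ X ∈ agreeing Y (Finset.univ \ {i}) := by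
    simp [agreeing, eq_comm]
  by_cases h : Y ∈ agreeing X (Finset.univ \ {i})
  · have heq : agreeing X (Finset.univ \ {i}) = agreeing Y (Finset.univ \ {i}) := by
      simp only [agreeing, Finset.mem_filter, Finset.mem_univ, true_and] at h ⊢
      rw [h]
    rw [condOn, condOn, if_pos h, if_pos (hsymm.1 h), heq]
    ring
  · rw [condOn, condOn, if_neg h, if_neg (fun h' => h (hsymm.2 h'))]
    ring

lemma glauber_stationary [Nonempty U] {μ : Finset U → ℝ} (hμ : ∀ S, 0 < μ S) (Y : Finset U) :
    ∑ X, μ X * glauber μ X Y = μ Y := by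
  simp only [glauber_reversible μ _ Y, ← Finset.mul_sum, glauber_row_sum hμ, mul_one]

end SingleSite

/-! ### Contraction of the expected discrepancy and the coupling inequality. -/

section Contraction

variable {U : Type*} [Fintype U] [DecidableEq U]

open Matrix in
/-- Distribution at time `t` of the coupled dynamics started from `(univ, Y)` with `Y ∼ μ`. -/
def coupledLaw (μ : Finset U → ℝ) (t : ℕ) : Finset U × Finset U → ℝ :=
  (fun z => (if z.1 = Finset.univ then 1 else 0) * μ z.2) ᵥ* coupled μ ^ t

lemma coupledLaw_zero (μ : Finset U → ℝ) (z : Finset U × Finset U) :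
    coupledLaw μ 0 z = (if z.1 = Finset.univ then 1 else 0) * μ z.2 := by
  simp [coupledLaw]

lemma coupledLaw_succ (μ : Finset U → ℝ) (t : ℕ) (w : Finset U × Finset U) :
    coupledLaw μ (t + 1) w = ∑ z, coupledLaw μ t z * coupled μ z w := by
  rw [coupledLaw, pow_succ, ← Matrix.vecMul_vecMul]
  rfl

lemma coupledLaw_nonneg {μ : Finset U → ℝ} (hμ : ∀ S, 0 < μ S) (t : ℕ)
    (z : Finset U × Finset U) : 0 ≤ coupledLaw μ t z := by
  induction t generalizing z with
  | zero => rw [coupledLaw_zero]; exact mul_nonneg (by split_ifs <;> norm_num) (hμ _).le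
  | succ t ih =>
    rw [coupledLaw_succ]
    exact Finset.sum_nonneg fun w _ => mul_nonneg (ih w) (coupled_nonneg hμ _ _)

lemma sum_coupledLaw_fst {μ : Finset U → ℝ} (hμ : ∀ S, 0 < μ S) (hsum : ∑ S, μ S = 1) (t : ℕ)
    (X : Finset U) : ∑ Y, coupledLaw μ t (X, Y) = (glauber μ ^ t) Finset.univ X := by
  induction t generalizing X with
  | zero =>
    calc ∑ Y, coupledLaw μ 0 (X, Y) = (if X = Finset.univ then 1 else 0) * ∑ Y, μ Y := by
          rw [Finset.mul_sum]
          exact Finset.sum_congr rfl fun Y _ => coupledLaw_zero μ (X, Y)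
      _ = _ := by
          rw [hsum, mul_one, pow_zero, Matrix.one_apply]
          simp only [eq_comm]
  | succ t ih =>
    simp only [coupledLaw_succ]
    rw [Finset.sum_comm]
    simp only [← Finset.mul_sum, sum_coupled_fst hμ]
    rw [Fintype.sum_prod_type, pow_succ, Matrix.mul_apply]
    simp only [← Finset.sum_mul, ih]

lemma sum_coupledLaw_snd [Nonempty U] {μ : Finset U → ℝ} (hμ : ∀ S, 0 < μ S) (t : ℕ)
    (Y : Finset U) : ∑ X, coupledLaw μ t (X, Y) = μ Y := by
  induction t generalizing Y with
  | zero => simp [coupledLaw_zero]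
  | succ t ih =>
    simp only [coupledLaw_succ]
    rw [Finset.sum_comm]
    simp only [← Finset.mul_sum, sum_coupled_snd hμ]
    rw [Fintype.sum_prod_type_right]
    simp only [← Finset.sum_mul, ih]
    exact glauber_stationary hμ Y

/-- The only outcome that can break the inclusion removes `i` above and inserts it below; its weight
vanishes by monotonicity. -/
lemma subset_of_coupled_ne_zero {μ : Finset U → ℝ}
    (hmono : ∀ X Y : Finset U, Y ⊆ X → ∀ i, addProb μ Y i ≤ addProb μ X i)
    {z w : Finset U × Finset U} (hz : z.2 ⊆ z.1) (h : coupled μ z w ≠ 0) : w.2 ⊆ w.1 := by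
  by_contra hw
  refine h ?_
  rw [coupled, Finset.sum_eq_zero, mul_zero]
  intro i _
  have h1 : (insert i z.1, insert i z.2) ≠ w := by
    rintro rfl; exact hw (Finset.insert_subset_insert _ hz)
  have h2 : (insert i z.1, z.2.erase i) ≠ w := by
    rintro rfl
    exact hw ((Finset.erase_subset _ _).trans (hz.trans (Finset.subset_insert _ _)))
  have h3 : (z.1.erase i, z.2.erase i) ≠ w := by
    rintro rfl; exact hw (Finset.erase_subset_erase _ hz)
  rw [if_neg h1, if_neg h2, if_neg h3, min_eq_right (hmono _ _ hz i)]
  ring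

lemma subset_of_coupledLaw_ne_zero {μ : Finset U → ℝ}
    (hmono : ∀ X Y : Finset U, Y ⊆ X → ∀ i, addProb μ Y i ≤ addProb μ X i)
    {t : ℕ} {z : Finset U × Finset U} (h : coupledLaw μ t z ≠ 0) : z.2 ⊆ z.1 := by
  induction t generalizing z with
  | zero =>
    rw [coupledLaw_zero] at h
    have : z.1 = Finset.univ := by
      by_contra hz; simp [hz] at h
    simp [this]
  | succ t ih =>
    rw [coupledLaw_succ] at h
    obtain ⟨w, -, hw⟩ := Finset.exists_ne_zero_of_sum_ne_zero h
    exact subset_of_coupled_ne_zero hmono (ih (left_ne_zero_of_mul hw)) (right_ne_zero_of_mul hw)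

/-- The total influence of a set of additional elements is at most half its size. -/
lemma sum_addProb_sub_le {μ : Finset U → ℝ} {Good : Finset U → Prop}
    (hup : ∀ X Y, Y ⊆ X → Good Y → Good X)
    (hinf : ∀ Z f, Good Z → f ∉ Z →
      ∑ i, (addProb μ (insert f Z) i - addProb μ Z i) ≤ 1 / 2)
    {Y : Finset U} (hY : Good Y) (F : Finset U) (hF : Disjoint F Y) :
    ∑ i, (addProb μ (F ∪ Y) i - addProb μ Y i) ≤ (F.card : ℝ) / 2 := by
  induction F using Finset.induction_on with
  | empty => simp
  | insert f F hf ih =>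
    rw [Finset.disjoint_insert_left] at hF
    have h1 := ih hF.2
    -- Every intermediate configuration contains `Y`, so it is good.
    have h2 := hinf (F ∪ Y) f (hup _ _ Finset.subset_union_right hY) (by
      simp [hf, hF.1])
    rw [Finset.insert_union, Finset.card_insert_of_notMem hf]
    have h3 : ∑ i, (addProb μ (insert f (F ∪ Y)) i - addProb μ Y i) =
        ∑ i, (addProb μ (insert f (F ∪ Y)) i - addProb μ (F ∪ Y) i) +
          ∑ i, (addProb μ (F ∪ Y) i - addProb μ Y i) := by
      rw [← Finset.sum_add_distrib]
      exact Finset.sum_congr rfl fun _ _ => by ring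
    rw [h3]
    push_cast
    linarith

/-- Updating `i` deletes it from the discrepancy and puts it back with probability equal to the gap
between the two update probabilities. -/
lemma sum_coupled_disc (μ : Finset U → ℝ)
    (hmono : ∀ X Y : Finset U, Y ⊆ X → ∀ i, addProb μ Y i ≤ addProb μ X i)
    [Nonempty U] {X Y : Finset U} (hYX : Y ⊆ X) :
    ∑ w, coupled μ (X, Y) w * ((w.1 \ w.2).card : ℝ) =
      (1 - 1 / (Fintype.card U : ℝ)) * ((X \ Y).card : ℝ) +
        (1 / (Fintype.card U : ℝ)) * ∑ i, (addProb μ X i - addProb μ Y i) := by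
  have hm : (Fintype.card U : ℝ) ≠ 0 := by simp
  rw [sum_coupled_mul]
  have key : ∀ i : U,
      (min (addProb μ X i) (addProb μ Y i) * ((insert i X \ insert i Y).card : ℝ) +
      (addProb μ X i - min (addProb μ X i) (addProb μ Y i)) * ((insert i X \ Y.erase i).card : ℝ) +
      (addProb μ Y i - min (addProb μ X i) (addProb μ Y i)) * ((X.erase i \ insert i Y).card : ℝ) +
      (1 - max (addProb μ X i) (addProb μ Y i)) * ((X.erase i \ Y.erase i).card : ℝ)) =
      ((X \ Y).card : ℝ) - (if i ∈ X \ Y then 1 else 0) + (addProb μ X i - addProb μ Y i) := by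
    intro i
    have e1 : insert i X \ insert i Y = (X \ Y).erase i := by
      ext j; by_cases hj : j = i <;> simp [hj]
    have e2 : insert i X \ Y.erase i = insert i ((X \ Y).erase i) := by
      ext j; by_cases hj : j = i <;> simp [hj]
    have e3 : X.erase i \ Y.erase i = (X \ Y).erase i := by
      ext j; by_cases hj : j = i <;> simp [hj]
    have c : (((X \ Y).erase i).card : ℝ) = (X \ Y).card - (if i ∈ X \ Y then 1 else 0) := by
      split_ifs with h
      · rw [Finset.card_erase_of_mem h, Nat.cast_sub (Finset.card_pos.2 ⟨i, h⟩), Nat.cast_one]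
      · rw [Finset.erase_eq_of_notMem h, sub_zero]
    rw [e1, e2, e3, Finset.card_insert_of_notMem (Finset.notMem_erase _ _), Nat.cast_add, c,
      min_eq_right (hmono X Y hYX i), max_eq_left (hmono X Y hYX i)]
    push_cast
    ring
  simp only [key]
  rw [Finset.sum_add_distrib, Finset.sum_sub_distrib]
  simp only [Finset.sum_const, Finset.card_univ, nsmul_eq_mul, Finset.sum_ite_mem,
    Finset.univ_inter, mul_one]
  field_simp

open Classical in
-- The recursion is `D (t+1) ≤ (1 - 1/(2m)) * D t + B` with `B` the bad mass. By stationarity of the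
-- second marginal `B` is the same at every time, and `2mB` is the fixed point of the error.
lemma expected_disc_le [Nonempty U] {μ : Finset U → ℝ} (hμ : ∀ S, 0 < μ S)
    (hmono : ∀ X Y : Finset U, Y ⊆ X → ∀ i, addProb μ Y i ≤ addProb μ X i)
    {Good : Finset U → Prop} (hup : ∀ X Y, Y ⊆ X → Good Y → Good X)
    (hinf : ∀ Z f, Good Z → f ∉ Z →
      ∑ i, (addProb μ (insert f Z) i - addProb μ Z i) ≤ 1 / 2) (t : ℕ) :
    ∑ z, coupledLaw μ t z * ((z.1 \ z.2).card : ℝ) ≤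
      (1 - 1 / (2 * (Fintype.card U : ℝ))) ^ t * ∑ S, μ S * ((Finset.univ \ S).card : ℝ) +
        2 * (Fintype.card U : ℝ) * ∑ S with ¬ Good S, μ S := by
  set m : ℝ := (Fintype.card U : ℝ) with hm
  have hm1 : 1 ≤ m := by rw [hm]; exact_mod_cast Fintype.card_pos
  set B := ∑ S with ¬ Good S, μ S with hB
  have hB0 : 0 ≤ B := Finset.sum_nonneg fun S _ => (hμ S).le
  have hstep : ∀ z : Finset U × Finset U, z.2 ⊆ z.1 →
      ∑ w, coupled μ z w * ((w.1 \ w.2).card : ℝ) ≤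
        (1 - 1 / (2 * m)) * ((z.1 \ z.2).card : ℝ) + (if Good z.2 then 0 else 1) := by
    rintro ⟨X, Y⟩ hz
    rw [sum_coupled_disc μ hmono hz, ← hm]
    have hd : (0 : ℝ) ≤ (X \ Y).card := Nat.cast_nonneg _
    by_cases hg : Good Y
    · have h := sum_addProb_sub_le hup hinf hg (X \ Y) Finset.sdiff_disjoint
      rw [Finset.sdiff_union_of_subset hz] at h
      simp only [hg, if_true, add_zero]
      have h' := mul_le_mul_of_nonneg_left h (show 0 ≤ 1 / m by positivity)
      refine (add_le_add_right h' _).trans (le_of_eq ?_)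
      field_simp
      ring
    · simp only [hg, if_false]
      -- From a bad configuration the influence is bounded trivially, at the cost of an additive
      -- `1`.
      have h : ∑ i, (addProb μ X i - addProb μ Y i) ≤ m := by
        rw [hm, ← nsmul_one, ← Finset.card_univ, ← Finset.sum_const]
        exact Finset.sum_le_sum fun i _ => by
          linarith [addProb_le_one hμ X i, addProb_nonneg hμ Y i]
      have h' := mul_le_mul_of_nonneg_left h (show 0 ≤ 1 / m by positivity)
      have h2 : 1 / m * m = 1 := by field_simp
      have h3 : 1 / (2 * m) ≤ 1 / m := by gcongr; linarith
      nlinarith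
  induction t with
  | zero =>
    simp only [coupledLaw_zero, pow_zero, one_mul]
    rw [Fintype.sum_prod_type, Finset.sum_eq_single Finset.univ]
    · simp only [if_true, one_mul]
      have : 0 ≤ 2 * m * B := by positivity
      linarith
    · intro b _ hb; simp [hb]
    · simp
  | succ t ih =>
    have hbad : ∑ z, coupledLaw μ t z * (if Good z.2 then (0 : ℝ) else 1) = B := by
      rw [Fintype.sum_prod_type_right, hB, Finset.sum_filter]
      refine Finset.sum_congr rfl fun Y _ => ?_
      refine (Finset.sum_mul Finset.univ (fun X => coupledLaw μ t (X, Y))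
        (if Good Y then (0 : ℝ) else 1)).symm.trans ?_
      rw [sum_coupledLaw_snd hμ]
      split_ifs <;> simp_all
    have hc : 0 ≤ 1 - 1 / (2 * m) := by
      rw [sub_nonneg, div_le_one (by positivity)]; linarith
    calc ∑ w, coupledLaw μ (t + 1) w * ((w.1 \ w.2).card : ℝ)
        = ∑ z, coupledLaw μ t z * ∑ w, coupled μ z w * ((w.1 \ w.2).card : ℝ) := by
          simp only [coupledLaw_succ, Finset.sum_mul, Finset.mul_sum, mul_assoc]
          rw [Finset.sum_comm]
      _ ≤ ∑ z, coupledLaw μ t z *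
            ((1 - 1 / (2 * m)) * ((z.1 \ z.2).card : ℝ) + (if Good z.2 then 0 else 1)) := by
          refine Finset.sum_le_sum fun z _ => ?_
          by_cases hz : coupledLaw μ t z = 0
          · simp [hz]
          · exact mul_le_mul_of_nonneg_left (hstep z (subset_of_coupledLaw_ne_zero hmono hz))
              (coupledLaw_nonneg hμ t z)
      _ = (1 - 1 / (2 * m)) * (∑ z, coupledLaw μ t z * ((z.1 \ z.2).card : ℝ)) + B := by
          rw [← hbad, Finset.mul_sum, ← Finset.sum_add_distrib]
          exact Finset.sum_congr rfl fun z _ => by ring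
      _ ≤ _ := by
          refine (add_le_add_left (mul_le_mul_of_nonneg_left ih hc) B).trans (le_of_eq ?_)
          rw [pow_succ]
          field_simp
          ring

lemma sum_coupledLaw_ne_le {μ : Finset U → ℝ} (hμ : ∀ S, 0 < μ S)
    (hmono : ∀ X Y : Finset U, Y ⊆ X → ∀ i, addProb μ Y i ≤ addProb μ X i) (t : ℕ) :
    ∑ z with z.1 ≠ z.2, coupledLaw μ t z ≤ ∑ z, coupledLaw μ t z * ((z.1 \ z.2).card : ℝ) := by
  rw [Finset.sum_filter]
  refine Finset.sum_le_sum fun z _ => ?_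
  have h0 := coupledLaw_nonneg hμ t z
  split_ifs with h
  · by_cases hz : coupledLaw μ t z = 0
    · simp [hz]
    · have hsub := subset_of_coupledLaw_ne_zero hmono hz
      have : 0 < (z.1 \ z.2).card := Finset.card_pos.2 <| Finset.sdiff_nonempty.2 fun h' =>
        h (h'.antisymm hsub)
      exact le_mul_of_one_le_right h0 (by exact_mod_cast this)
  · positivity

/-- The coupling inequality: a pair with distinct entries contributes at most `2` to the `ℓ¹`
distance, which cancels the factor `1/2`. -/
lemma tvDist_le_sum_coupledLaw [Nonempty U] {μ : Finset U → ℝ} (hμ : ∀ S, 0 < μ S)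
    (hsum : ∑ S, μ S = 1) (t : ℕ) :
    tvDist (fun Y => (glauber μ ^ t) Finset.univ Y) μ ≤ ∑ z with z.1 ≠ z.2, coupledLaw μ t z := by
  have key : ∀ S : Finset U, |(glauber μ ^ t) Finset.univ S - μ S| ≤
      ∑ z : Finset U × Finset U, coupledLaw μ t z *
        |(if z.1 = S then (1 : ℝ) else 0) - (if z.2 = S then 1 else 0)| := by
    intro S
    have h1 : (glauber μ ^ t) Finset.univ S =
        ∑ z : Finset U × Finset U, coupledLaw μ t z * (if z.1 = S then (1 : ℝ) else 0) := by
      rw [← sum_coupledLaw_fst hμ hsum, Fintype.sum_prod_type_right]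
      simp
    have h2 : μ S =
        ∑ z : Finset U × Finset U, coupledLaw μ t z * (if z.2 = S then (1 : ℝ) else 0) := by
      nth_rw 1 [← sum_coupledLaw_snd hμ t S]
      rw [Fintype.sum_prod_type]
      simp
    rw [h1, h2, ← Finset.sum_sub_distrib]
    refine (Finset.abs_sum_le_sum_abs _ _).trans (le_of_eq ?_)
    refine Finset.sum_congr rfl fun z _ => ?_
    rw [← mul_sub, abs_mul, abs_of_nonneg (coupledLaw_nonneg hμ t z)]
  have h2 : ∀ z : Finset U × Finset U,
      ∑ S, |(if z.1 = S then (1 : ℝ) else 0) - (if z.2 = S then 1 else 0)| ≤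
        if z.1 ≠ z.2 then 2 else 0 := by
    intro z
    split_ifs with h
    · calc _ ≤ ∑ S, ((if z.1 = S then (1 : ℝ) else 0) + (if z.2 = S then 1 else 0)) := by
            refine Finset.sum_le_sum fun S _ => ?_
            split_ifs <;> norm_num
        _ = 2 := by simp [Finset.sum_add_distrib]; norm_num
    · simp [not_not.1 h]
  calc tvDist (fun Y => (glauber μ ^ t) Finset.univ Y) μ
      ≤ 1 / 2 * ∑ S, ∑ z : Finset U × Finset U, coupledLaw μ t z *
        |(if z.1 = S then (1 : ℝ) else 0) - (if z.2 = S then 1 else 0)| :=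
        mul_le_mul_of_nonneg_left (Finset.sum_le_sum fun S _ => key S) (by norm_num)
    _ ≤ 1 / 2 * ∑ z : Finset U × Finset U, coupledLaw μ t z * if z.1 ≠ z.2 then 2 else 0 := by
        rw [Finset.sum_comm]
        simp only [← Finset.mul_sum]
        refine mul_le_mul_of_nonneg_left (Finset.sum_le_sum fun z _ => ?_) (by norm_num)
        exact mul_le_mul_of_nonneg_left (h2 z) (coupledLaw_nonneg hμ t z)
    _ = _ := by
        rw [Finset.sum_filter, Finset.mul_sum]
        refine Finset.sum_congr rfl fun z _ => ?_
        split_ifs <;> ring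

end Contraction

/-! ### Markov chains on finite sets: path events, lumping, existence. -/

section Chains

/-- The unnormalised law at time `k` of a chain killed when it leaves `A i` at time `i`. -/
def killedLaw {Ω : Type*} [Fintype Ω] (ν : Ω → ℝ) (K : Matrix Ω Ω ℝ) (A : ℕ → Finset Ω) :
    ℕ → Ω → ℝ
  | 0 => ν
  | k + 1 => fun w => ∑ z ∈ A k, killedLaw ν K A k z * K z w

lemma killedLaw_nonneg {Ω : Type*} [Fintype Ω] {ν : Ω → ℝ} (hν : ∀ z, 0 ≤ ν z)
    {K : Matrix Ω Ω ℝ} (hK : ∀ z w, 0 ≤ K z w) (A : ℕ → Finset Ω) (k : ℕ) (z : Ω) :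
    0 ≤ killedLaw ν K A k z := by
  induction k generalizing z with
  | zero => exact hν z
  | succ k ih => exact Finset.sum_nonneg fun w _ => mul_nonneg (ih w) (hK _ _)

open Matrix in
lemma killedLaw_univ {Ω : Type*} [Fintype Ω] [DecidableEq Ω] (ν : Ω → ℝ) (K : Matrix Ω Ω ℝ)
    (k : ℕ) : killedLaw ν K (fun _ => Finset.univ) k = ν ᵥ* K ^ k := by
  induction k with
  | zero => simp [killedLaw]
  | succ k ih =>
    rw [pow_succ, ← Matrix.vecMul_vecMul, ← ih]
    rfl

lemma IsMarkovChain.measurableSet_forall_lt {S : Type*} [MeasurableSpace S] {ℙ : Measure S}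
    {Ω : Type*} {ν : Ω → ℝ} {K : Matrix Ω Ω ℝ} {Z : ℕ → S → Ω} (hZ : IsMarkovChain ℙ ν K Z)
    (k : ℕ) (A : ℕ → Finset Ω) : MeasurableSet {s | ∀ i < k, Z i s ∈ A i} := by
  have : {s | ∀ i < k, Z i s ∈ A i} = ⋂ i, ⋂ _ : i < k, ⋃ z ∈ A i, {s | Z i s = z} := by
    ext s; simp
  rw [this]
  exact MeasurableSet.iInter fun i => MeasurableSet.iInter fun _ =>
    Finset.measurableSet_biUnion _ fun z _ => hZ.1 i z

/-- `IsMarkovChain` prescribes only probabilities of fully specified paths. The induction on `k`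
frees one more initial coordinate by summing over its values in `A k`. -/
lemma measure_killed {S : Type*} [MeasurableSpace S] {ℙ : Measure S} {Ω : Type*} [Fintype Ω]
    [DecidableEq Ω] {ν : Ω → ℝ} (hν : ∀ z, 0 ≤ ν z) {K : Matrix Ω Ω ℝ} (hK : ∀ z w, 0 ≤ K z w)
    {Z : ℕ → S → Ω} (hZ : IsMarkovChain ℙ ν K Z) (A : ℕ → Finset Ω) (t k : ℕ) (hk : k ≤ t)
    (x : ℕ → Ω) :
    ℙ {s | (∀ i < k, Z i s ∈ A i) ∧ ∀ i, k ≤ i → i ≤ t → Z i s = x i} =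
      ENNReal.ofReal (killedLaw ν K A k (x k) * ∏ i ∈ Finset.Ico k t, K (x i) (x (i + 1))) := by
  induction k generalizing x with
  | zero => simpa [killedLaw] using hZ.2 t x
  | succ k ih =>
    have hset : {s | (∀ i < k + 1, Z i s ∈ A i) ∧ ∀ i, k + 1 ≤ i → i ≤ t → Z i s = x i} =
        ⋃ z ∈ A k, {s | (∀ i < k, Z i s ∈ A i) ∧
          ∀ i, k ≤ i → i ≤ t → Z i s = Function.update x k z i} := by
      ext s
      simp only [Set.mem_ofPred_eq, Set.mem_iUnion, exists_prop]
      constructor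
      · rintro ⟨h1, h2⟩
        refine ⟨Z k s, h1 k (Nat.lt_succ_self k), fun i hi => h1 i (by omega), fun i hi hit => ?_⟩
        rcases eq_or_lt_of_le hi with rfl | hi
        · simp
        · rw [Function.update_of_ne (by omega)]; exact h2 i hi hit
      · rintro ⟨z, hz, h1, h2⟩
        refine ⟨fun i hi => ?_, fun i hi hit => ?_⟩
        · rcases eq_or_lt_of_le (Nat.lt_succ_iff.1 hi) with rfl | hi
          · have := h2 i le_rfl (by omega)
            simp only [Function.update_self] at this
            rwa [this]
          · exact h1 i hi
        · have := h2 i (by omega) hit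
          rwa [Function.update_of_ne (by omega)] at this
    have hmeas : ∀ y : ℕ → Ω, MeasurableSet {s | (∀ i < k, Z i s ∈ A i) ∧
        ∀ i, k ≤ i → i ≤ t → Z i s = y i} := by
      intro y
      have h : MeasurableSet {s | ∀ i, k ≤ i → i ≤ t → Z i s = y i} := by
        have : {s | ∀ i, k ≤ i → i ≤ t → Z i s = y i} =
            ⋂ i, ⋂ _ : k ≤ i, ⋂ _ : i ≤ t, {s | Z i s = y i} := by
          ext s; simp
        rw [this]
        exact MeasurableSet.iInter fun i => MeasurableSet.iInter fun _ =>
          MeasurableSet.iInter fun _ => hZ.1 i _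
      exact (hZ.measurableSet_forall_lt k A).inter h
    rw [hset, measure_biUnion_finset ?_ fun z _ => hmeas _]
    · have hprod : ∀ z, ∏ i ∈ Finset.Ico k t,
          K (Function.update x k z i) (Function.update x k z (i + 1)) =
          K z (x (k + 1)) * ∏ i ∈ Finset.Ico (k + 1) t, K (x i) (x (i + 1)) := by
        intro z
        rw [Finset.prod_eq_prod_Ico_succ_bot (by omega : k < t)]
        congr 1
        · simp
        · refine Finset.prod_congr rfl fun i hi => ?_
          have := (Finset.mem_Ico.1 hi).1
          rw [Function.update_of_ne (by omega), Function.update_of_ne (by omega)]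
      rw [Finset.sum_congr rfl fun z _ => ih (by omega) (Function.update x k z)]
      simp only [Function.update_self, hprod]
      rw [← ENNReal.ofReal_sum_of_nonneg]
      · simp only [← mul_assoc, ← Finset.sum_mul]
        rfl
      · intro z _
        exact mul_nonneg (killedLaw_nonneg hν hK _ _ _)
          (mul_nonneg (hK _ _) (Finset.prod_nonneg fun _ _ => hK _ _))
    · intro z _ w _ hzw
      refine Set.disjoint_left.2 fun s hs hs' => hzw ?_
      have h1 := hs.2 k le_rfl (by omega)
      have h2 := hs'.2 k le_rfl (by omega)
      simp only [Function.update_self] at h1 h2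
      rw [← h1, ← h2]

lemma measure_killed_eq {S : Type*} [MeasurableSpace S] {ℙ : Measure S} {Ω : Type*} [Fintype Ω]
    [DecidableEq Ω] {ν : Ω → ℝ} (hν : ∀ z, 0 ≤ ν z) {K : Matrix Ω Ω ℝ} (hK : ∀ z w, 0 ≤ K z w)
    {Z : ℕ → S → Ω} (hZ : IsMarkovChain ℙ ν K Z) (A : ℕ → Finset Ω) (t : ℕ) (z : Ω) :
    ℙ {s | (∀ i < t, Z i s ∈ A i) ∧ Z t s = z} = ENNReal.ofReal (killedLaw ν K A t z) := by
  have h := measure_killed hν hK hZ A t t le_rfl fun _ => z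
  simp only [Finset.Ico_self, Finset.prod_empty, mul_one] at h
  rw [← h]
  congr 1
  ext s
  simp only [Set.mem_ofPred_eq, and_congr_right_iff]
  refine fun _ => ⟨fun h i h1 h2 => ?_, fun h => h t le_rfl le_rfl⟩
  obtain rfl := le_antisymm h2 h1
  exact h

open Matrix in
lemma measure_mem_eq {S : Type*} [MeasurableSpace S] {ℙ : Measure S} {Ω : Type*} [Fintype Ω]
    [DecidableEq Ω] {ν : Ω → ℝ} (hν : ∀ z, 0 ≤ ν z) {K : Matrix Ω Ω ℝ} (hK : ∀ z w, 0 ≤ K z w)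
    {Z : ℕ → S → Ω} (hZ : IsMarkovChain ℙ ν K Z) (t : ℕ) (B : Finset Ω) :
    ℙ {s | Z t s ∈ B} = ENNReal.ofReal (∑ z ∈ B, (ν ᵥ* K ^ t) z) := by
  have hset : {s | Z t s ∈ B} = ⋃ z ∈ B, {s | Z t s = z} := by ext s; simp
  rw [hset, measure_biUnion_finset ?_ fun z _ => hZ.1 t z]
  · rw [ENNReal.ofReal_sum_of_nonneg]
    · refine Finset.sum_congr rfl fun z _ => ?_
      rw [← killedLaw_univ, ← measure_killed_eq hν hK hZ]
      simp
    · intro z _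
      rw [← killedLaw_univ]
      exact killedLaw_nonneg hν hK _ _ _
  · intro z _ w _ hzw
    exact Set.disjoint_left.2 fun s hs hs' => hzw (by rw [← hs, ← hs'])

/-- A function of a Markov chain is a Markov chain if the transition matrix is lumpable. -/
lemma IsMarkovChain.lump {S : Type*} [MeasurableSpace S] {ℙ : Measure S} {Ω Ω' : Type*} [Fintype Ω]
    [DecidableEq Ω] [DecidableEq Ω'] {ν : Ω → ℝ} (hν : ∀ z, 0 ≤ ν z) {K : Matrix Ω Ω ℝ}
    (hK : ∀ z w, 0 ≤ K z w) {Z : ℕ → S → Ω} (hZ : IsMarkovChain ℙ ν K Z) (f : Ω → Ω')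
    {ν' : Ω' → ℝ} {P : Matrix Ω' Ω' ℝ} (hν' : ∀ x, ∑ z with f z = x, ν z = ν' x)
    (hP : ∀ z x, ∑ w with f w = x, K z w = P (f z) x) :
    IsMarkovChain ℙ ν' P fun t s => f (Z t s) := by
  refine ⟨fun t x => ?_, fun t x => ?_⟩
  · have : {s | f (Z t s) = x} = ⋃ z ∈ Finset.univ.filter (fun z => f z = x), {s | Z t s = z} := by
      ext s; simp
    rw [this]
    exact Finset.measurableSet_biUnion _ fun z _ => hZ.1 t z
  · set A : ℕ → Finset Ω := fun i => Finset.univ.filter fun z => f z = x i with hA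
    have hset : {s | ∀ i ≤ t, f (Z i s) = x i} =
        ⋃ z ∈ A t, {s | (∀ i < t, Z i s ∈ A i) ∧ Z t s = z} := by
      ext s
      simp only [hA, Finset.mem_filter, Finset.mem_univ, true_and, Set.mem_ofPred_eq,
        Set.mem_iUnion, exists_prop]
      constructor
      · exact fun h => ⟨_, h t le_rfl, fun i hi => h i hi.le, rfl⟩
      · rintro ⟨z, hz, h1, rfl⟩ i hi
        rcases eq_or_lt_of_le hi with rfl | hi
        · exact hz
        · exact h1 i hi
    have hmeas : ∀ z, MeasurableSet {s | (∀ i < t, Z i s ∈ A i) ∧ Z t s = z} := by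
      intro z
      exact (hZ.measurableSet_forall_lt t A).inter (hZ.1 t z)
    -- Lumpability makes the transition mass into the next fibre depend only on the current fibre,
    -- so the sum factors.
    have hlaw : ∀ k, ∑ z ∈ A k, killedLaw ν K A k z =
        ν' (x 0) * ∏ i ∈ Finset.range k, P (x i) (x (i + 1)) := by
      intro k
      induction k with
      | zero => simpa [killedLaw, hA] using hν' (x 0)
      | succ k ih =>
        simp only [killedLaw]
        rw [Finset.sum_comm, Finset.prod_range_succ, ← mul_assoc, ← ih, Finset.sum_mul]
        refine Finset.sum_congr rfl fun z hz => ?_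
        rw [← Finset.mul_sum, hA, hP, (Finset.mem_filter.1 hz).2]
    rw [hset, measure_biUnion_finset ?_ fun z _ => hmeas z]
    · simp only [measure_killed_eq hν hK hZ]
      rw [← ENNReal.ofReal_sum_of_nonneg fun z _ => killedLaw_nonneg hν hK _ _ _, hlaw]
    · intro z _ w _ hzw
      exact Set.disjoint_left.2 fun s hs hs' => hzw (by rw [← hs.2, ← hs'.2])

/-- The measure on a finite set with given nonnegative weights. -/
def weightMeasure {Ω : Type*} [Fintype Ω] (ν : Ω → ℝ) : @Measure Ω ⊤ :=
  @Measure.sum Ω Ω ⊤ fun z => ENNReal.ofReal (ν z) • @Measure.dirac Ω ⊤ z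

lemma weightMeasure_apply {Ω : Type*} [Fintype Ω] [DecidableEq Ω] (ν : Ω → ℝ) (A : Set Ω) :
    weightMeasure ν A = ∑ z, ENNReal.ofReal (ν z) * A.indicator 1 z := by
  let _ : MeasurableSpace Ω := ⊤
  rw [weightMeasure, Measure.sum_apply _ (MeasurableSpace.measurableSet_top), tsum_fintype]
  refine Finset.sum_congr rfl fun z _ => ?_
  rw [Measure.smul_apply, Measure.dirac_apply' _ (MeasurableSpace.measurableSet_top)]
  rfl

/-- The space carries independent variables: one for the initial state (`none`) and, for each time
and state, the move made from there. Path events then become finite cylinders of an infinite product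
measure. -/
theorem exists_markovChain {Ω : Type u} [Fintype Ω] [DecidableEq Ω] {ν : Ω → ℝ}
    (hν : ∀ z, 0 ≤ ν z) (hνs : ∑ z, ν z = 1) {K : Matrix Ω Ω ℝ} (hK : ∀ z w, 0 ≤ K z w)
    (hKs : ∀ z, ∑ w, K z w = 1) :
    ∃ (S : Type u) (_ : MeasurableSpace S) (ℙ : Measure S) (_ : IsProbabilityMeasure ℙ)
      (Z : ℕ → S → Ω), IsMarkovChain ℙ ν K Z := by
  let _ : MeasurableSpace Ω := ⊤
  let κ : Option (ℕ × Ω) → Measure Ω := fun o => weightMeasure (o.elim ν fun j => K j.2)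
  have hκ : ∀ o, IsProbabilityMeasure (κ o) := by
    intro o
    refine ⟨?_⟩
    rw [weightMeasure_apply]
    simp only [Set.indicator_univ, Pi.one_apply, mul_one]
    rw [← ENNReal.ofReal_sum_of_nonneg]
    · rcases o with _ | j
      · simp [hνs]
      · simp [hKs]
    · rcases o with _ | j
      · exact fun z _ => hν z
      · exact fun z _ => hK _ z
  have hκs : ∀ o z, κ o {z} = ENNReal.ofReal (o.elim ν (fun j => K j.2) z) := by
    intro o z
    rw [weightMeasure_apply, Finset.sum_eq_single z]
    · simp
    · intro w _ hw; simp [hw]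
    · simp
  let Z : ℕ → (Option (ℕ × Ω) → Ω) → Ω := fun t s =>
    Nat.rec (s none) (fun i z => s (some (i, z))) t
  have hZ0 : ∀ s, Z 0 s = s none := fun s => rfl
  have hZs : ∀ t s, Z (t + 1) s = s (some (t, Z t s)) := fun t s => rfl
  have hpath : ∀ (t : ℕ) (x : ℕ → Ω) (s : Option (ℕ × Ω) → Ω), (∀ i ≤ t, Z i s = x i) ↔
      s none = x 0 ∧ ∀ i < t, s (some (i, x i)) = x (i + 1) := by
    intro t x s
    constructor
    · intro h
      refine ⟨h 0 (Nat.zero_le t), fun i hi => ?_⟩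
      rw [← h i hi.le, ← h (i + 1) hi]
    · rintro ⟨h0, h1⟩ i hi
      induction i with
      | zero => exact h0
      | succ i ih => rw [hZs, ih (by omega), h1 i hi]
  refine ⟨Option (ℕ × Ω) → Ω, inferInstance, Measure.infinitePi κ, inferInstance, Z, ?_, ?_⟩
  · intro t x
    have hm : Measurable (Z t) := by
      induction t with
      | zero => exact measurable_pi_apply none
      | succ t ih =>
        have : Measurable fun q : Ω × (Option (ℕ × Ω) → Ω) => q.2 (some (t, q.1)) :=
          measurable_from_prod_countable_right fun z =>
            (measurable_pi_apply (some (t, z)) :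
              Measurable fun s : Option (ℕ × Ω) → Ω => s (some (t, z)))
        exact this.comp (ih.prodMk measurable_id)
    exact hm (MeasurableSpace.measurableSet_top (s := {x}))
  · intro t x
    let J : Finset (Option (ℕ × Ω)) :=
      insert none ((Finset.range t).image fun i => some (i, x i))
    let y : Option (ℕ × Ω) → Ω := fun o => o.elim (x 0) fun j => x (j.1 + 1)
    have hset : {s | ∀ i ≤ t, Z i s = x i} = Set.pi (J : Set (Option (ℕ × Ω))) fun o => {y o} := by
      ext s
      rw [Set.mem_ofPred_eq, hpath]
      simp [J, y, Set.mem_pi]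
    rw [hset, Measure.infinitePi_pi _ fun _ _ => MeasurableSpace.measurableSet_top]
    simp only [hκs]
    rw [Finset.prod_insert (by simp), Finset.prod_image, ENNReal.ofReal_mul (hν _),
      ENNReal.ofReal_prod_of_nonneg fun _ _ => hK _ _]
    · rfl
    -- The coordinates used along a path are distinct because their times are, even if a state is
    -- revisited.
    · intro i _ j _ h
      simp only [Option.some.injEq, Prod.mk.injEq] at h
      exact h.1

end Chains

/-! ### Clusters of a configuration and the effect of adding an edge. -/

section Clusters

variable {V : Type u} [Fintype V] [DecidableEq V] (G : SimpleGraph V) [DecidableRel G.Adj]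

open Classical in
/-- The vertex set of the connected component of `v` in `(V, S)`. -/
def cluster (S : Finset G.edgeSet) (v : V) : Finset V :=
  Finset.univ.filter fun w => (spanning G S).Reachable v w

open Classical in
/-- The edges of `G` with exactly one endpoint in `A`. -/
def boundary (A : Finset V) : Finset G.edgeSet :=
  Finset.univ.filter fun e => ∃ u v, (e : Sym2 V) = s(u, v) ∧ u ∈ A ∧ v ∉ A

variable {G}

lemma mem_boundary {A : Finset V} {e : G.edgeSet} :
    e ∈ boundary G A ↔ ∃ u v, (e : Sym2 V) = s(u, v) ∧ u ∈ A ∧ v ∉ A := by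
  simp [boundary]

lemma mem_boundary_of_eq {A : Finset V} {e : G.edgeSet} {u v : V} (he : (e : Sym2 V) = s(u, v)) :
    e ∈ boundary G A ↔ ¬(u ∈ A ↔ v ∈ A) := by
  rw [mem_boundary]
  constructor
  · rintro ⟨a, b, hab, ha, hb⟩
    rw [he, Sym2.eq_iff] at hab
    rcases hab with ⟨rfl, rfl⟩ | ⟨rfl, rfl⟩ <;> tauto
  · intro h
    by_cases hu : u ∈ A
    · exact ⟨u, v, he, hu, by tauto⟩
    · exact ⟨v, u, he.trans Sym2.eq_swap, by tauto, hu⟩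

lemma exists_endpoints (e : G.edgeSet) : ∃ u v, (e : Sym2 V) = s(u, v) := by
  induction h : (e : Sym2 V) with | _ u v => exact ⟨u, v, rfl⟩

lemma edge_ne {e : G.edgeSet} {u v : V} (he : (e : Sym2 V) = s(u, v)) : u ≠ v := by
  have h := e.2
  rw [he, SimpleGraph.mem_edgeSet] at h
  exact h.ne

lemma mem_cluster {S : Finset G.edgeSet} {v w : V} :
    w ∈ cluster G S v ↔ (spanning G S).Reachable v w := by
  simp [cluster]

lemma self_mem_cluster (S : Finset G.edgeSet) (v : V) : v ∈ cluster G S v :=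
  mem_cluster.2 (SimpleGraph.Reachable.refl v)

lemma cluster_eq_of_mem {S : Finset G.edgeSet} {v w : V} (h : w ∈ cluster G S v) :
    cluster G S w = cluster G S v := by
  ext z
  rw [mem_cluster] at h
  rw [mem_cluster, mem_cluster]
  exact ⟨fun h' => h.trans h', fun h' => h.symm.trans h'⟩

lemma mem_cluster_comm {S : Finset G.edgeSet} {v w : V} :
    w ∈ cluster G S v ↔ v ∈ cluster G S w := by
  rw [mem_cluster, mem_cluster]
  exact ⟨fun h => h.symm, fun h => h.symm⟩

lemma mem_cluster_of_edge {S : Finset G.edgeSet} {e : G.edgeSet} (heS : e ∈ S) {u v x : V}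
    (he : (e : Sym2 V) = s(u, v)) (hu : u ∈ cluster G S x) : v ∈ cluster G S x := by
  rw [mem_cluster] at *
  refine hu.trans (SimpleGraph.Adj.reachable ?_)
  rw [spanning, SimpleGraph.fromEdgeSet_adj]
  exact ⟨⟨e, heS, he⟩, edge_ne he⟩

lemma notMem_boundary_cluster {S : Finset G.edgeSet} {e : G.edgeSet} (heS : e ∈ S) (x : V) :
    e ∉ boundary G (cluster G S x) := by
  rw [mem_boundary]
  rintro ⟨u, v, he, hu, hv⟩
  exact hv (mem_cluster_of_edge heS he hu)

/-- A walk in `(V, S)` cannot leave a set with no boundary edge in `S`. The upper bounds on clusters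
below come from this. -/
lemma cluster_subset_of_closed {S : Finset G.edgeSet} {A : Finset V}
    (hA : ∀ e ∈ S, e ∉ boundary G A) {v : V} (hv : v ∈ A) : cluster G S v ⊆ A := by
  intro w hw
  rw [mem_cluster] at hw
  obtain ⟨p⟩ := hw
  induction p with
  | nil => exact hv
  | cons h _ ih =>
    rw [spanning, SimpleGraph.fromEdgeSet_adj] at h
    obtain ⟨⟨e, heS, he⟩, -⟩ := h
    refine ih ?_
    by_contra hb
    exact hA e heS (mem_boundary.2 ⟨_, _, he, hv, hb⟩)

lemma cluster_mono {S T : Finset G.edgeSet} (h : S ⊆ T) (v : V) :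
    cluster G S v ⊆ cluster G T v :=
  cluster_subset_of_closed (fun _ he => notMem_boundary_cluster (h he) v) (self_mem_cluster T v)

lemma cluster_insert_of_mem {S : Finset G.edgeSet} {e : G.edgeSet} {u v w : V}
    (he : (e : Sym2 V) = s(u, v)) (hw : w ∈ cluster G S u ∪ cluster G S v) :
    cluster G (insert e S) w = cluster G S u ∪ cluster G S v := by
  have hsub := Finset.subset_insert e S
  have hv : v ∈ cluster G (insert e S) u :=
    mem_cluster_of_edge (Finset.mem_insert_self e S) he (self_mem_cluster _ u)
  have h1 : cluster G S u ∪ cluster G S v ⊆ cluster G (insert e S) u := by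
    refine Finset.union_subset (cluster_mono hsub u) ?_
    rw [← cluster_eq_of_mem hv]
    exact cluster_mono hsub v
  refine Finset.Subset.antisymm (cluster_subset_of_closed ?_ hw) ?_
  · intro g hg hgb
    rcases Finset.mem_insert.1 hg with rfl | hg
    · rw [mem_boundary_of_eq he] at hgb
      simp [self_mem_cluster] at hgb
    · rw [mem_boundary] at hgb
      obtain ⟨a, b, hab, ha, hb⟩ := hgb
      rw [Finset.mem_union] at ha hb
      exact hb (ha.imp (mem_cluster_of_edge hg hab) (mem_cluster_of_edge hg hab))
  · rw [cluster_eq_of_mem (h1 hw)]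
    exact h1

lemma cluster_insert_of_notMem {S : Finset G.edgeSet} {e : G.edgeSet} {u v w : V}
    (he : (e : Sym2 V) = s(u, v)) (hw : w ∉ cluster G S u ∪ cluster G S v) :
    cluster G (insert e S) w = cluster G S w := by
  refine Finset.Subset.antisymm (cluster_subset_of_closed ?_ (self_mem_cluster S w))
    (cluster_mono (Finset.subset_insert e S) w)
  intro g hg hgb
  rcases Finset.mem_insert.1 hg with rfl | hg
  · rw [mem_boundary_of_eq he, mem_cluster_comm, mem_cluster_comm (w := v)] at hgb
    rw [Finset.mem_union] at hw
    tauto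
  · exact notMem_boundary_cluster hg w hgb

lemma cluster_insert_of_connected {S : Finset G.edgeSet} {e : G.edgeSet} {u v : V}
    (he : (e : Sym2 V) = s(u, v)) (huv : v ∈ cluster G S u) (w : V) :
    cluster G (insert e S) w = cluster G S w := by
  by_cases hw : w ∈ cluster G S u ∪ cluster G S v
  · rw [cluster_insert_of_mem he hw, cluster_eq_of_mem huv, Finset.union_self]
    rw [cluster_eq_of_mem huv, Finset.union_self] at hw
    rw [cluster_eq_of_mem hw]
  · exact cluster_insert_of_notMem he hw

lemma disjoint_cluster {S : Finset G.edgeSet} {u v : V} (huv : v ∉ cluster G S u) :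
    Disjoint (cluster G S u) (cluster G S v) := by
  refine Finset.disjoint_left.2 fun w h1 h2 => huv ?_
  rw [← cluster_eq_of_mem h1, cluster_eq_of_mem h2]
  exact self_mem_cluster S v

/-- Product of the external fields over the cluster of `v`. -/
def clusterField (lam : V → ℝ) (S : Finset G.edgeSet) (v : V) : ℝ :=
  ∏ j ∈ cluster G S v, lam j

/-- The factor of the random cluster weight that depends on the connected components. -/
def clusterWeight (lam : V → ℝ) (S : Finset G.edgeSet) : ℝ :=
  ∏ A ∈ Finset.univ.image (cluster G S), (1 + ∏ j ∈ A, lam j)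

/-- Replacing components by their vertex sets indexes the product by finsets of `V`, which can be
compared for different configurations. -/
lemma weight_eq (p : G.edgeSet → ℝ) (lam : V → ℝ) (S : Finset G.edgeSet) :
    weight G p lam S =
      (∏ e ∈ S, p e) * (∏ f ∈ Finset.univ \ S, (1 - p f)) * clusterWeight lam S := by
  classical
  rw [weight, clusterWeight]
  congr 1
  refine Finset.prod_bij (fun C _ => C.supp.toFinset) ?_ ?_ ?_ ?_
  · intro C _
    induction C using SimpleGraph.ConnectedComponent.ind with
    | h v =>
      refine Finset.mem_image.2 ⟨v, Finset.mem_univ _, ?_⟩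
      ext w
      rw [mem_cluster, Set.mem_toFinset, SimpleGraph.ConnectedComponent.mem_supp_iff,
        SimpleGraph.ConnectedComponent.eq]
      exact ⟨fun h => h.symm, fun h => h.symm⟩
  · intro C _ D _ h
    exact SimpleGraph.ConnectedComponent.supp_injective (Set.toFinset_inj.1 h)
  · intro A hA
    obtain ⟨v, -, rfl⟩ := Finset.mem_image.1 hA
    refine ⟨(spanning G S).connectedComponentMk v, Finset.mem_univ _, ?_⟩
    ext w
    rw [mem_cluster, Set.mem_toFinset, SimpleGraph.ConnectedComponent.mem_supp_iff,
      SimpleGraph.ConnectedComponent.eq]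
    exact ⟨fun h => h.symm, fun h => h.symm⟩
  · intro C _
    rfl

lemma clusterWeight_insert_of_connected (lam : V → ℝ) {S : Finset G.edgeSet} {e : G.edgeSet}
    {u v : V} (he : (e : Sym2 V) = s(u, v)) (huv : v ∈ cluster G S u) :
    clusterWeight lam (insert e S) = clusterWeight lam S := by
  rw [clusterWeight, clusterWeight, funext (cluster_insert_of_connected he huv)]

/-- The new edge replaces the two clusters of `u` and `v` by their union and leaves the remaining
family `R` untouched. -/
lemma clusterWeight_insert_of_not_connected (lam : V → ℝ) {S : Finset G.edgeSet} {e : G.edgeSet}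
    {u v : V} (he : (e : Sym2 V) = s(u, v)) (huv : v ∉ cluster G S u) :
    clusterWeight lam (insert e S) *
        ((1 + clusterField lam S u) * (1 + clusterField lam S v)) =
      clusterWeight lam S * (1 + clusterField lam S u * clusterField lam S v) := by
  set M := cluster G S u ∪ cluster G S v with hM
  set R := (Finset.univ.filter fun w => w ∉ M).image (cluster G S) with hR
  have hu : u ∈ M := Finset.mem_union_left _ (self_mem_cluster S u)
  have hv : v ∈ M := Finset.mem_union_right _ (self_mem_cluster S v)
  have hRM : ∀ A ∈ R, ∃ w ∈ A, w ∉ M := by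
    intro A hA
    obtain ⟨w, hw, rfl⟩ := Finset.mem_image.1 hA
    exact ⟨w, self_mem_cluster S w, (Finset.mem_filter.1 hw).2⟩
  have h1 : Finset.univ.image (cluster G S) =
      insert (cluster G S u) (insert (cluster G S v) R) := by
    ext A
    simp only [hR, Finset.mem_image, Finset.mem_insert, Finset.mem_filter, Finset.mem_univ,
      true_and]
    constructor
    · rintro ⟨w, rfl⟩
      by_cases hw : w ∈ M
      · rcases Finset.mem_union.1 hw with hw | hw
        · exact Or.inl (cluster_eq_of_mem hw)
        · exact Or.inr (Or.inl (cluster_eq_of_mem hw))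
      · exact Or.inr (Or.inr ⟨w, hw, rfl⟩)
    · rintro (rfl | rfl | ⟨w, -, rfl⟩)
      exacts [⟨u, rfl⟩, ⟨v, rfl⟩, ⟨w, rfl⟩]
  have h2 : Finset.univ.image (cluster G (insert e S)) = insert M R := by
    ext A
    simp only [hR, Finset.mem_image, Finset.mem_insert, Finset.mem_filter, Finset.mem_univ,
      true_and]
    constructor
    · rintro ⟨w, rfl⟩
      by_cases hw : w ∈ M
      · exact Or.inl (cluster_insert_of_mem he hw)
      · exact Or.inr ⟨w, hw, (cluster_insert_of_notMem he hw).symm⟩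
    · rintro (rfl | ⟨w, hw, rfl⟩)
      · exact ⟨u, cluster_insert_of_mem he hu⟩
      · exact ⟨w, cluster_insert_of_notMem he hw⟩
  have n1 : M ∉ R := fun h => by
    obtain ⟨w, hw, hw'⟩ := hRM _ h; exact hw' hw
  have n2 : cluster G S v ∉ R := fun h => by
    obtain ⟨w, hw, hw'⟩ := hRM _ h; exact hw' (Finset.mem_union_right _ hw)
  have n3 : cluster G S u ∉ insert (cluster G S v) R := fun h => by
    rcases Finset.mem_insert.1 h with h | h
    · exact huv (h ▸ self_mem_cluster S v)
    · obtain ⟨w, hw, hw'⟩ := hRM _ h; exact hw' (Finset.mem_union_left _ hw)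
  rw [clusterWeight, clusterWeight, h1, h2, Finset.prod_insert n1, Finset.prod_insert n3,
    Finset.prod_insert n2, hM, Finset.prod_union (disjoint_cluster huv)]
  simp only [clusterField]
  ring

end Clusters

/-! ### Weight ratios and how a second edge changes them. -/

section Ratio

/-- Here `a`, `b` are the fields of two clusters that an edge joins. The bound by `2` is `(1 - a) *
(1 - b) ≥ 0`; the last bound serves when another edge joins the same clusters and the ratio drops to
`1`. -/
lemma mergeRatio_bounds {a b : ℝ} (ha : 0 ≤ a) (ha1 : a ≤ 1) (hb : 0 ≤ b) (hb1 : b ≤ 1) :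
    1 ≤ (1 + a) * (1 + b) / (1 + a * b) ∧ (1 + a) * (1 + b) / (1 + a * b) ≤ 2 ∧
      (1 + a) * (1 + b) / (1 + a * b) ≤ 1 + (a + b) := by
  have hab : 0 ≤ a * b := mul_nonneg ha hb
  have hpos : 0 < 1 + a * b := by linarith
  refine ⟨(one_le_div hpos).2 (by nlinarith), (div_le_iff₀ hpos).2 (by nlinarith),
    (div_le_iff₀ hpos).2 ?_⟩
  nlinarith [mul_nonneg hab (add_nonneg ha hb)]

/-- Enlarging one cluster multiplies its field by some `c ≤ 1`. The difference has numerator `a * (1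
- c) * (1 - b ^ 2)` and denominator at least `1`. -/
lemma mergeRatio_sub {a b c : ℝ} (ha : 0 ≤ a) (hb : 0 ≤ b) (hb1 : b ≤ 1) (hc : 0 ≤ c)
    (hc1 : c ≤ 1) :
    0 ≤ (1 + a) * (1 + b) / (1 + a * b) - (1 + a * c) * (1 + b) / (1 + a * c * b) ∧
      (1 + a) * (1 + b) / (1 + a * b) - (1 + a * c) * (1 + b) / (1 + a * c * b) ≤ a := by
  have hab : 0 ≤ a * b := mul_nonneg ha hb
  have hacb : 0 ≤ a * c * b := mul_nonneg (mul_nonneg ha hc) hb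
  have h1 : 0 < 1 + a * b := by linarith
  have h2 : 0 < 1 + a * c * b := by linarith
  have heq : (1 + a) * (1 + b) / (1 + a * b) - (1 + a * c) * (1 + b) / (1 + a * c * b) =
      a * ((1 - c) * (1 - b ^ 2)) / ((1 + a * b) * (1 + a * c * b)) := by
    rw [div_sub_div _ _ h1.ne' h2.ne']
    congr 1
    ring
  have hb2 : 0 ≤ 1 - b ^ 2 := by nlinarith
  have hcb : 0 ≤ (1 - c) * (1 - b ^ 2) := mul_nonneg (by linarith) hb2
  have hcb1 : (1 - c) * (1 - b ^ 2) ≤ 1 := mul_le_one₀ (by linarith) hb2 (by nlinarith)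
  rw [heq]
  refine ⟨div_nonneg (mul_nonneg ha hcb) (mul_pos h1 h2).le, (div_le_iff₀ (mul_pos h1 h2)).2 ?_⟩
  refine mul_le_mul_of_nonneg_left (hcb1.trans ?_) ha
  nlinarith [mul_nonneg hab hacb]

variable {V : Type u} [Fintype V] [DecidableEq V] {G : SimpleGraph V} [DecidableRel G.Adj]
  {lam : V → ℝ}

lemma clusterField_nonneg (hlam : ∀ v, 0 ≤ lam v ∧ lam v < 1) (S : Finset G.edgeSet) (v : V) :
    0 ≤ clusterField lam S v :=
  Finset.prod_nonneg fun j _ => (hlam j).1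

lemma clusterField_le_one (hlam : ∀ v, 0 ≤ lam v ∧ lam v < 1) (S : Finset G.edgeSet) (v : V) :
    clusterField lam S v ≤ 1 :=
  Finset.prod_le_one (fun j _ => (hlam j).1) fun j _ => (hlam j).2.le

lemma clusterField_le_pow (hlam : ∀ v, 0 ≤ lam v ∧ lam v < 1) {ρ : ℝ} (hρ : ∀ v, lam v ≤ ρ)
    (S : Finset G.edgeSet) (v : V) : clusterField lam S v ≤ ρ ^ (cluster G S v).card := by
  rw [← Finset.prod_const]
  exact Finset.prod_le_prod (fun j _ => (hlam j).1) fun j _ => hρ j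

lemma clusterWeight_pos (hlam : ∀ v, 0 ≤ lam v ∧ lam v < 1) (S : Finset G.edgeSet) :
    0 < clusterWeight lam S :=
  Finset.prod_pos fun A _ => by
    have : 0 ≤ ∏ j ∈ A, lam j := Finset.prod_nonneg fun j _ => (hlam j).1
    linarith

/-- The factor by which the cluster weight drops when `e` is added to `S`. -/
def ratio (lam : V → ℝ) (S : Finset G.edgeSet) (e : G.edgeSet) : ℝ :=
  clusterWeight lam S / clusterWeight lam (insert e S)

lemma ratio_of_connected (hlam : ∀ v, 0 ≤ lam v ∧ lam v < 1) {S : Finset G.edgeSet}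
    {e : G.edgeSet} {u v : V} (he : (e : Sym2 V) = s(u, v)) (huv : v ∈ cluster G S u) :
    ratio lam S e = 1 := by
  rw [ratio, clusterWeight_insert_of_connected lam he huv]
  exact div_self (clusterWeight_pos hlam S).ne'

lemma ratio_of_not_connected (hlam : ∀ v, 0 ≤ lam v ∧ lam v < 1) {S : Finset G.edgeSet}
    {e : G.edgeSet} {u v : V} (he : (e : Sym2 V) = s(u, v)) (huv : v ∉ cluster G S u) :
    ratio lam S e = (1 + clusterField lam S u) * (1 + clusterField lam S v) /
      (1 + clusterField lam S u * clusterField lam S v) := by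
  have h := clusterWeight_insert_of_not_connected lam he huv
  have h1 := clusterWeight_pos hlam (insert e S)
  have h2 := mul_nonneg (clusterField_nonneg hlam S u) (clusterField_nonneg hlam S v)
  rw [ratio, div_eq_div_iff h1.ne' (by linarith), ← h]
  ring

lemma ratio_bounds (hlam : ∀ v, 0 ≤ lam v ∧ lam v < 1) (S : Finset G.edgeSet) (e : G.edgeSet) :
    1 ≤ ratio lam S e ∧ ratio lam S e ≤ 2 := by
  obtain ⟨u, v, he⟩ := exists_endpoints e
  by_cases huv : v ∈ cluster G S u
  · rw [ratio_of_connected hlam he huv]; norm_num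
  · rw [ratio_of_not_connected hlam he huv]
    have := mergeRatio_bounds (clusterField_nonneg hlam S u) (clusterField_le_one hlam S u)
      (clusterField_nonneg hlam S v) (clusterField_le_one hlam S v)
    exact ⟨this.1, this.2.1⟩

lemma ratio_insert_of_mem_of_notMem (hlam : ∀ v, 0 ≤ lam v ∧ lam v < 1) {S : Finset G.edgeSet}
    {e f : G.edgeSet} {u v x y : V} (he : (e : Sym2 V) = s(u, v)) (hf : (f : Sym2 V) = s(x, y))
    (hxy : y ∉ cluster G S x) (hu : u ∈ cluster G S x) (hv : v ∉ cluster G S x ∪ cluster G S y) :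
    e ∈ boundary G (cluster G S x) ∧ 0 ≤ ratio lam S e - ratio lam (insert f S) e ∧
      ratio lam S e - ratio lam (insert f S) e ≤ clusterField lam S x := by
  have huM : u ∈ cluster G S x ∪ cluster G S y := Finset.mem_union_left _ hu
  have hcu := cluster_insert_of_mem hf huM
  have hcv := cluster_insert_of_notMem hf hv
  have hvx : v ∉ cluster G S x := fun h => hv (Finset.mem_union_left _ h)
  have hn1 : v ∉ cluster G S u := by rwa [cluster_eq_of_mem hu]
  have hn2 : v ∉ cluster G (insert f S) u := by rwa [hcu]
  have hFu : clusterField lam S u = clusterField lam S x := by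
    rw [clusterField, cluster_eq_of_mem hu, clusterField]
  have hFu' : clusterField lam (insert f S) u = clusterField lam S x * clusterField lam S y := by
    rw [clusterField, hcu, Finset.prod_union (disjoint_cluster hxy)]; rfl
  have hFv' : clusterField lam (insert f S) v = clusterField lam S v := by
    rw [clusterField, hcv, clusterField]
  rw [ratio_of_not_connected hlam he hn1, ratio_of_not_connected hlam he hn2, hFu, hFu', hFv']
  exact ⟨(mem_boundary_of_eq he).2 (by tauto), mergeRatio_sub (clusterField_nonneg hlam S x)
    (clusterField_nonneg hlam S v) (clusterField_le_one hlam S v) (clusterField_nonneg hlam S y)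
    (clusterField_le_one hlam S y)⟩

/-- The influence of connecting `x` to something on the ratio at `e`. -/
def localInfluence (lam : V → ℝ) (S : Finset G.edgeSet) (x : V) (e : G.edgeSet) : ℝ :=
  if e ∈ boundary G (cluster G S x) then clusterField lam S x else 0

lemma localInfluence_nonneg (hlam : ∀ v, 0 ≤ lam v ∧ lam v < 1) (S : Finset G.edgeSet) (x : V)
    (e : G.edgeSet) : 0 ≤ localInfluence lam S x e := by
  rw [localInfluence]
  split_ifs
  exacts [clusterField_nonneg hlam S x, le_rfl]

/-- Only edges leaving a cluster joined by `f` are affected: either one end of `e` lies in the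
merged cluster (`mergeRatio_sub`), or `e` joins the same two clusters as `f`. In all other cases the
ratio is unchanged. -/
lemma ratio_sub_ratio_insert (hlam : ∀ v, 0 ≤ lam v ∧ lam v < 1) (S : Finset G.edgeSet)
    (e f : G.edgeSet) {x y : V} (hf : (f : Sym2 V) = s(x, y)) :
    0 ≤ ratio lam S e - ratio lam (insert f S) e ∧
      ratio lam S e - ratio lam (insert f S) e ≤
        localInfluence lam S x e + localInfluence lam S y e := by
  have hIx := localInfluence_nonneg hlam S x e
  have hIy := localInfluence_nonneg hlam S y e
  obtain ⟨u, v, he⟩ := exists_endpoints e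
  have he' : (e : Sym2 V) = s(v, u) := he.trans Sym2.eq_swap
  have hf' : (f : Sym2 V) = s(y, x) := hf.trans Sym2.eq_swap
  by_cases huv : v ∈ cluster G S u
  · rw [ratio_of_connected hlam he huv, ratio_of_connected hlam he
      (cluster_mono (Finset.subset_insert f S) u huv)]
    constructor <;> linarith
  by_cases hxy : y ∈ cluster G S x
  · have hc := cluster_insert_of_connected hf hxy
    have h1 : v ∉ cluster G (insert f S) u := by rwa [hc]
    rw [ratio_of_not_connected hlam he huv, ratio_of_not_connected hlam he h1]
    simp only [clusterField, hc, sub_self]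
    exact ⟨le_rfl, by linarith⟩
  have hyx : x ∉ cluster G S y := fun h => hxy (mem_cluster_comm.1 h)
  have hone : ∀ a b, (e : Sym2 V) = s(a, b) → a ∈ cluster G S x ∪ cluster G S y →
      b ∉ cluster G S x ∪ cluster G S y →
      0 ≤ ratio lam S e - ratio lam (insert f S) e ∧
      ratio lam S e - ratio lam (insert f S) e ≤
        localInfluence lam S x e + localInfluence lam S y e := by
    intro a b hab ha hb
    rcases Finset.mem_union.1 ha with ha | ha
    · obtain ⟨h1, h2, h3⟩ := ratio_insert_of_mem_of_notMem hlam hab hf hxy ha hb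
      have : localInfluence lam S x e = clusterField lam S x := by rw [localInfluence, if_pos h1]
      exact ⟨h2, by linarith⟩
    · rw [Finset.union_comm] at hb
      obtain ⟨h1, h2, h3⟩ := ratio_insert_of_mem_of_notMem hlam hab hf' hyx ha hb
      have : localInfluence lam S y e = clusterField lam S y := by rw [localInfluence, if_pos h1]
      exact ⟨h2, by linarith⟩
  by_cases hu : u ∈ cluster G S x ∪ cluster G S y
  · by_cases hv : v ∈ cluster G S x ∪ cluster G S y
    · have hcu := cluster_insert_of_mem hf hu
      have h1 : v ∈ cluster G (insert f S) u := by rwa [hcu]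
      rw [ratio_of_connected hlam he h1, ratio_of_not_connected hlam he huv]
      have hb := mergeRatio_bounds (clusterField_nonneg hlam S u) (clusterField_le_one hlam S u)
        (clusterField_nonneg hlam S v) (clusterField_le_one hlam S v)
      refine ⟨by linarith [hb.1], ?_⟩
      -- Now `e` crosses between the two clusters, so it lies in both boundaries and both influences
      -- are nonzero terms of the bound.
      have htwo : ∀ a b, (e : Sym2 V) = s(a, b) → a ∈ cluster G S x → b ∈ cluster G S y →
          clusterField lam S a + clusterField lam S b =
            localInfluence lam S x e + localInfluence lam S y e := by
        intro a b hab ha hb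
        have hax : a ∉ cluster G S y := fun h => Finset.disjoint_left.1 (disjoint_cluster hxy) ha h
        have hbx : b ∉ cluster G S x := fun h => Finset.disjoint_left.1 (disjoint_cluster hxy) h hb
        rw [localInfluence, localInfluence, if_pos ((mem_boundary_of_eq hab).2 (by tauto)),
          if_pos ((mem_boundary_of_eq hab).2 (by tauto)), clusterField, clusterField,
          cluster_eq_of_mem ha, cluster_eq_of_mem hb]
        rfl
      have hsum : clusterField lam S u + clusterField lam S v =
          localInfluence lam S x e + localInfluence lam S y e := by
        rcases Finset.mem_union.1 hu with hu | hu <;> rcases Finset.mem_union.1 hv with hv | hv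
        · rw [← cluster_eq_of_mem hu] at hv; exact absurd hv huv
        · exact htwo u v he hu hv
        · rw [add_comm]; exact htwo v u he' hv hu
        · rw [← cluster_eq_of_mem hu] at hv; exact absurd hv huv
      linarith [hb.2.2]
    · exact hone u v he hu hv
  · by_cases hv : v ∈ cluster G S x ∪ cluster G S y
    · exact hone v u he' hv hu
    · have hcu := cluster_insert_of_notMem hf hu
      have hcv := cluster_insert_of_notMem hf hv
      have h1 : v ∉ cluster G (insert f S) u := by rwa [hcu]
      rw [ratio_of_not_connected hlam he huv, ratio_of_not_connected hlam he h1]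
      simp only [clusterField, hcu, hcv, sub_self]
      exact ⟨le_rfl, by linarith⟩

end Ratio

/-! ### Total influence of an edge: bridges and boundary edges. -/

section Influence

variable {V : Type u} [Fintype V] [DecidableEq V] {G : SimpleGraph V} [DecidableRel G.Adj]
  {lam : V → ℝ}

lemma geom_sum_le {ρ : ℝ} (h0 : 0 ≤ ρ) (h1 : ρ < 1) (n : ℕ) :
    ∑ j ∈ Finset.range n, ρ ^ j ≤ 1 / (1 - ρ) := by
  rw [le_div_iff₀ (by linarith), mul_comm, mul_neg_geom_sum]
  linarith [pow_nonneg h0 n]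

/-- Each of the `n` terms `ρ ^ j`, `j < n`, of the geometric sum is at least `ρ ^ n`. -/
lemma card_mul_pow_le {ρ : ℝ} (h0 : 0 ≤ ρ) (h1 : ρ < 1) (n : ℕ) :
    (n : ℝ) * ρ ^ n ≤ 1 / (1 - ρ) := by
  refine le_trans ?_ (geom_sum_le h0 h1 n)
  rw [← nsmul_eq_mul]
  nth_rw 1 [← Finset.card_range n]
  refine Finset.card_nsmul_le_sum _ _ _ fun j hj => ?_
  exact pow_le_pow_of_le_one h0 h1.le (Finset.mem_range.1 hj).le

lemma sum_le_of_unique_ne_zero {ι : Type*} {s : Finset ι} {g : ι → ℝ} {c : ℝ} (hc : 0 ≤ c)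
    (hg : ∀ i ∈ s, g i ≠ 0 → g i ≤ c)
    (huniq : ∀ i ∈ s, ∀ j ∈ s, g i ≠ 0 → g j ≠ 0 → i = j) : ∑ i ∈ s, g i ≤ c := by
  by_cases h : ∃ i ∈ s, g i ≠ 0
  · obtain ⟨i, hi, hi0⟩ := h
    rw [Finset.sum_eq_single_of_mem i hi fun j hj hji => by
      by_contra hj0
      exact hji (huniq j hj i hi hj0 hi0)]
    exact hg i hi hi0
  · push Not at h
    rw [Finset.sum_eq_zero h]
    exact hc

/-- The edges of `Z` with both endpoints in `A`. -/
def edgesInside (Z : Finset G.edgeSet) (A : Finset V) : Finset G.edgeSet :=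
  Z.filter fun e => ∀ v ∈ (e : Sym2 V), v ∈ A

lemma mem_edgesInside {Z : Finset G.edgeSet} {A : Finset V} {e : G.edgeSet} {u v : V}
    (he : (e : Sym2 V) = s(u, v)) : e ∈ edgesInside Z A ↔ e ∈ Z ∧ u ∈ A ∧ v ∈ A := by
  simp [edgesInside, he]

lemma edgesInside_singleton (Z : Finset G.edgeSet) (x : V) : edgesInside Z {x} = ∅ := by
  refine Finset.eq_empty_of_forall_notMem fun e he => ?_
  obtain ⟨u, v, huv⟩ := exists_endpoints e
  rw [mem_edgesInside huv, Finset.mem_singleton, Finset.mem_singleton] at he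
  exact edge_ne huv (he.2.1.trans he.2.2.symm)

/-- Every bridge of `Z` is weighted by `ρ` to the number of vertices on the side of `x`; adding the
vertices of the cluster of `x` one by one, each new vertex brings at most one bridge. -/
lemma sum_bridges_le {ρ : ℝ} (h0 : 0 ≤ ρ) (h1 : ρ < 1) (Z : Finset G.edgeSet) (x : V) :
    ∑ e ∈ Z, (if e ∈ boundary G (cluster G (Z.erase e) x) then
      ρ ^ (cluster G (Z.erase e) x).card else 0) ≤ 1 / (1 - ρ) := by
  classical
  set T : G.edgeSet → ℝ := fun e => if e ∈ boundary G (cluster G (Z.erase e) x) then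
      ρ ^ (cluster G (Z.erase e) x).card else 0 with hT
  have hT0 : ∀ e, T e ≠ 0 → e ∈ boundary G (cluster G (Z.erase e) x) := fun e he => by
    by_contra h; simp [hT, h] at he
  -- The middle clause says that `A` is held together by the edges inside it: deleting any other
  -- edge of `Z` keeps `A` attached to `x`. A set of maximal size with this property will be the
  -- whole cluster.
  let Q : Finset V → Prop := fun A => x ∈ A ∧
    (∀ e ∈ Z, e ∉ edgesInside Z A → A ⊆ cluster G (Z.erase e) x) ∧
    ∑ e ∈ edgesInside Z A, T e ≤ ∑ j ∈ Finset.range A.card, ρ ^ j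
  have hQx : Q {x} := by
    refine ⟨Finset.mem_singleton_self x, fun e _ _ => ?_, ?_⟩
    · exact Finset.singleton_subset_iff.2 (self_mem_cluster _ x)
    · rw [edgesInside_singleton]; simp
  obtain ⟨A, hA, hmax⟩ := Finset.exists_max_image (Finset.univ.filter Q) Finset.card
    ⟨{x}, by simpa using hQx⟩
  obtain ⟨hxA, hconn, hsum⟩ : Q A := (Finset.mem_filter.1 hA).2
  have hclosed : ∀ e ∈ Z, e ∉ boundary G A := by
    intro e heZ heA
    obtain ⟨u, w, he, hu, hw⟩ := mem_boundary.1 heA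
    have hcard : (insert w A).card = A.card + 1 := Finset.card_insert_of_notMem hw
    have hin : ∀ g, g ∈ edgesInside Z A → g ∈ edgesInside Z (insert w A) := by
      intro g hg
      obtain ⟨a, b, hab⟩ := exists_endpoints g
      rw [mem_edgesInside hab] at hg ⊢
      exact ⟨hg.1, Finset.mem_insert_of_mem hg.2.1, Finset.mem_insert_of_mem hg.2.2⟩
    have hein : e ∈ edgesInside Z (insert w A) :=
      (mem_edgesInside he).2 ⟨heZ, Finset.mem_insert_of_mem hu, Finset.mem_insert_self w A⟩
    have hQ : Q (insert w A) := by
      refine ⟨Finset.mem_insert_of_mem hxA, fun g hgZ hg => ?_, ?_⟩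
      · have hsub := hconn g hgZ fun h => hg (hin g h)
        refine Finset.insert_subset ?_ hsub
        have hne : e ≠ g := by rintro rfl; exact hg hein
        exact mem_cluster_of_edge (Finset.mem_erase.2 ⟨hne, heZ⟩) he (hsub hu)
      · have hnew : ∀ g ∈ edgesInside Z (insert w A) \ edgesInside Z A,
            g ∈ Z ∧ A ⊆ cluster G (Z.erase g) x ∧ ∃ a ∈ A, (g : Sym2 V) = s(a, w) := by
          intro g hg
          rw [Finset.mem_sdiff] at hg
          obtain ⟨a, b, hab⟩ := exists_endpoints g
          have h1 := (mem_edgesInside hab).1 hg.1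
          refine ⟨h1.1, hconn g h1.1 hg.2, ?_⟩
          have hne := edge_ne hab
          have h2 := fun h => hg.2 ((mem_edgesInside hab).2 h)
          rw [Finset.mem_insert, Finset.mem_insert] at h1
          rcases h1 with ⟨hgZ, rfl | ha, rfl | hb⟩
          · exact absurd rfl hne
          · exact ⟨b, hb, hab.trans Sym2.eq_swap⟩
          · exact ⟨a, ha, hab⟩
          · exact absurd ⟨hgZ, ha, hb⟩ h2
        -- If `w` stayed connected to `x` after deleting `g`, both ends of `g` would lie on the side
        -- of `x` and `g` would not be a bridge.
        have hwout : ∀ g a, a ∈ A → (g : Sym2 V) = s(a, w) → (hg : g ∈ G.edgeSet) →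
            A ⊆ cluster G (Z.erase ⟨g, hg⟩) x → T ⟨g, hg⟩ ≠ 0 →
            w ∉ cluster G (Z.erase ⟨g, hg⟩) x := by
          intro g a ha hga hg hsub hTg hwin
          have := hT0 _ hTg
          rw [mem_boundary_of_eq hga] at this
          exact this ⟨fun _ => hwin, fun _ => hsub ha⟩
        rw [hcard, Finset.sum_range_succ,
          ← Finset.sum_sdiff (fun g hg => hin g hg), add_comm]
        refine add_le_add hsum (sum_le_of_unique_ne_zero (pow_nonneg h0 _) ?_ ?_)
        · intro g hg hTg
          obtain ⟨-, hsub, -⟩ := hnew g hg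
          simp only [hT, if_pos (hT0 g hTg)]
          exact pow_le_pow_of_le_one h0 h1.le (Finset.card_le_card hsub)
        -- A second new edge `g'` would still attach `w` to `A` after `g` is deleted, so `g` could
        -- not be a bridge.
        · intro g hg g' hg' hTg _
          by_contra hne
          obtain ⟨-, hsub, a, ha, hga⟩ := hnew g hg
          obtain ⟨hgZ', -, a', ha', hga'⟩ := hnew g' hg'
          exact hwout g a ha hga g.2 hsub hTg (mem_cluster_of_edge
            (Finset.mem_erase.2 ⟨Ne.symm hne, hgZ'⟩) hga' (hsub ha'))
    have := hmax (insert w A) (Finset.mem_filter.2 ⟨Finset.mem_univ _, hQ⟩)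
    omega
  have hle : ∑ e ∈ Z, T e = ∑ e ∈ edgesInside Z A, T e := by
    refine (Finset.sum_subset (Finset.filter_subset _ _) fun e heZ he => ?_).symm
    by_contra hTe
    obtain ⟨u, v, huv, hu, -⟩ := mem_boundary.1 (hT0 e hTe)
    have huA : u ∈ A := cluster_subset_of_closed hclosed hxA
      (cluster_mono (Finset.erase_subset e Z) x hu)
    have hvA : v ∈ A := by
      by_contra hv
      exact hclosed e heZ (mem_boundary.2 ⟨u, v, huv, huA, hv⟩)
    exact he ((mem_edgesInside huv).2 ⟨heZ, huA, hvA⟩)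
  rw [hle]
  exact hsum.trans (geom_sum_le h0 h1 _)

variable (G) in
/-- Every vertex set that is disconnected from its complement in `Z` has small boundary. -/
def SmallCuts (ℓ : ℝ) (Z : Finset G.edgeSet) : Prop :=
  ∀ A : Finset V, A.Nonempty → Disjoint (boundary G A) Z → ((boundary G A).card : ℝ) ≤ A.card * ℓ

lemma SmallCuts.mono {ℓ : ℝ} {X Y : Finset G.edgeSet} (hYX : Y ⊆ X) (h : SmallCuts G ℓ Y) :
    SmallCuts G ℓ X :=
  fun A hA hd => h A hA (hd.mono_right hYX)

/-- Edges in `Z` contribute only as bridges, giving the `1`. For edges outside `Z` nothing is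
erased, so the cluster `A` of `x` in `Z` is fixed, and the cut condition applies because no edge of
`Z` leaves `A`. -/
lemma sum_localInfluence_le (hlam : ∀ v, 0 ≤ lam v ∧ lam v < 1) {ρ : ℝ} (hρ : ∀ v, lam v ≤ ρ)
    (h1 : ρ < 1) {ℓ : ℝ} (hℓ : 0 ≤ ℓ) {Z : Finset G.edgeSet} (hZ : SmallCuts G ℓ Z) (x : V) :
    ∑ e, localInfluence lam (Z.erase e) x e ≤ (1 + ℓ) / (1 - ρ) := by
  have h0 : 0 ≤ ρ := (hlam x).1.trans (hρ x)
  have hL : ∀ e, localInfluence lam (Z.erase e) x e ≤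
      if e ∈ boundary G (cluster G (Z.erase e) x) then
        ρ ^ (cluster G (Z.erase e) x).card else 0 := by
    intro e
    rw [localInfluence]
    split_ifs
    exacts [clusterField_le_pow hlam hρ _ x, le_rfl]
  rw [← Finset.sum_add_sum_compl Z, add_div]
  refine add_le_add ((Finset.sum_le_sum fun e _ => hL e).trans (sum_bridges_le h0 h1 Z x)) ?_
  set A := cluster G Z x with hA
  have hcard : ((boundary G A).card : ℝ) ≤ A.card * ℓ := by
    refine hZ A ⟨x, self_mem_cluster Z x⟩ (Finset.disjoint_left.2 fun e he heZ => ?_)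
    exact notMem_boundary_cluster heZ x he
  calc ∑ e ∈ Zᶜ, localInfluence lam (Z.erase e) x e
      ≤ ∑ e ∈ Zᶜ, if e ∈ boundary G A then ρ ^ A.card else 0 := by
        refine Finset.sum_le_sum fun e he => ?_
        have := hL e
        rw [Finset.erase_eq_of_notMem (Finset.mem_compl.1 he)] at this ⊢
        exact this
    _ ≤ ∑ e, if e ∈ boundary G A then ρ ^ A.card else 0 := by
        refine Finset.sum_le_sum_of_subset_of_nonneg (Finset.subset_univ _) fun e _ _ => ?_
        split_ifs
        exacts [pow_nonneg h0 _, le_rfl]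
    _ = (boundary G A).card * ρ ^ A.card := by
        rw [Finset.sum_ite_mem, Finset.univ_inter, Finset.sum_const, nsmul_eq_mul]
    _ ≤ (A.card * ℓ) * ρ ^ A.card := mul_le_mul_of_nonneg_right hcard (pow_nonneg h0 _)
    _ = ℓ * (A.card * ρ ^ A.card) := by ring
    _ ≤ ℓ * (1 / (1 - ρ)) := mul_le_mul_of_nonneg_left (card_mul_pow_le h0 h1 _) hℓ
    _ = ℓ / (1 - ρ) := by ring

end Influence

/-! ### The random cluster measure: influence bounds and rare bad cuts. -/

section Model

variable {V : Type u} [Fintype V] [DecidableEq V] {G : SimpleGraph V} [DecidableRel G.Adj]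
  {p : G.edgeSet → ℝ} {lam : V → ℝ}

lemma weight_pos (hp : ∀ e, 0 < p e ∧ p e < 1) (hlam : ∀ v, 0 ≤ lam v ∧ lam v < 1)
    (S : Finset G.edgeSet) : 0 < weight G p lam S := by
  rw [weight_eq]
  exact mul_pos (mul_pos (Finset.prod_pos fun e _ => (hp e).1)
    (Finset.prod_pos fun e _ => sub_pos.2 (hp e).2)) (clusterWeight_pos hlam S)

lemma sum_weight_pos (hp : ∀ e, 0 < p e ∧ p e < 1) (hlam : ∀ v, 0 ≤ lam v ∧ lam v < 1) :
    0 < ∑ T, weight G p lam T :=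
  Finset.sum_pos (fun S _ => weight_pos hp hlam S) ⟨∅, Finset.mem_univ _⟩

lemma rcDist_pos (hp : ∀ e, 0 < p e ∧ p e < 1) (hlam : ∀ v, 0 ≤ lam v ∧ lam v < 1)
    (S : Finset G.edgeSet) : 0 < rcDist G p lam S :=
  div_pos (weight_pos hp hlam S) (sum_weight_pos hp hlam)

lemma sum_rcDist (hp : ∀ e, 0 < p e ∧ p e < 1) (hlam : ∀ v, 0 ≤ lam v ∧ lam v < 1) :
    ∑ S, rcDist G p lam S = 1 := by
  simp only [rcDist, ← Finset.sum_div]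
  exact div_self (sum_weight_pos hp hlam).ne'

lemma weight_mul_eq (hlam : ∀ v, 0 ≤ lam v ∧ lam v < 1) {S : Finset G.edgeSet} {e : G.edgeSet}
    (he : e ∉ S) :
    weight G p lam S * p e = weight G p lam (insert e S) * ((1 - p e) * ratio lam S e) := by
  have h : clusterWeight lam S = clusterWeight lam (insert e S) * ratio lam S e := by
    rw [ratio, mul_div_cancel₀]
    exact (clusterWeight_pos hlam _).ne'
  have hs : Finset.univ \ S = insert e (Finset.univ \ insert e S) := by
    ext g; by_cases hg : g = e <;> simp [hg, he]
  rw [weight_eq, weight_eq, h, hs, Finset.prod_insert he, Finset.prod_insert (by simp)]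
  ring

lemma addProb_rcDist (hp : ∀ e, 0 < p e ∧ p e < 1) (hlam : ∀ v, 0 ≤ lam v ∧ lam v < 1)
    (X : Finset G.edgeSet) (e : G.edgeSet) :
    addProb (rcDist G p lam) X e = p e / (p e + (1 - p e) * ratio lam (X.erase e) e) := by
  have h := weight_mul_eq (p := p) hlam (Finset.notMem_erase e X)
  have hins : insert e (X.erase e) = insert e X := by ext g; by_cases hg : g = e <;> simp [hg]
  rw [hins] at h
  have hr := (ratio_bounds hlam (X.erase e) e).1
  have h1 := weight_pos hp hlam (insert e X)
  have h2 := weight_pos hp hlam (X.erase e)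
  have hZ := sum_weight_pos (G := G) hp hlam
  have h3 : 0 < p e + (1 - p e) * ratio lam (X.erase e) e :=
    add_pos (hp e).1 (mul_pos (sub_pos.2 (hp e).2) (by linarith))
  have h4 : addProb (rcDist G p lam) X e =
      weight G p lam (insert e X) / (weight G p lam (insert e X) + weight G p lam (X.erase e)) := by
    rw [addProb, rcDist, rcDist]
    field_simp
  rw [h4, div_eq_div_iff (by positivity) h3.ne']
  linear_combination -h

/-- Ratios at least `1` make both denominators at least `1`, so the numerator `p * (1 - p) * (s -
s')` already bounds the difference. -/
lemma heatBath_sub {p s s' : ℝ} (hp0 : 0 < p) (hp1 : p < 1) (hs' : 1 ≤ s') (hss : s' ≤ s) :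
    0 ≤ p / (p + (1 - p) * s') - p / (p + (1 - p) * s) ∧
      p / (p + (1 - p) * s') - p / (p + (1 - p) * s) ≤ (1 - p) * (s - s') := by
  have h1 : 1 ≤ p + (1 - p) * s' := by nlinarith
  have h2 : 1 ≤ p + (1 - p) * s := by nlinarith
  have h3 : 0 ≤ (1 - p) * (s - s') := mul_nonneg (by linarith) (by linarith)
  rw [div_sub_div _ _ (by linarith) (by linarith)]
  have h4 : p * (p + (1 - p) * s) - (p + (1 - p) * s') * p = p * ((1 - p) * (s - s')) := by ring
  rw [h4]
  have h5 : 1 ≤ (p + (1 - p) * s') * (p + (1 - p) * s) := one_le_mul_of_one_le_of_one_le h1 h2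
  refine ⟨by positivity, (div_le_iff₀ (by linarith)).2 ?_⟩
  nlinarith

lemma addProb_insert_sub (hp : ∀ e, 0 < p e ∧ p e < 1) (hlam : ∀ v, 0 ≤ lam v ∧ lam v < 1)
    (Z : Finset G.edgeSet) (e f : G.edgeSet) {x y : V} (hf : (f : Sym2 V) = s(x, y)) :
    0 ≤ addProb (rcDist G p lam) (insert f Z) e - addProb (rcDist G p lam) Z e ∧
      addProb (rcDist G p lam) (insert f Z) e - addProb (rcDist G p lam) Z e ≤
        (1 - p e) * (localInfluence lam (Z.erase e) x e + localInfluence lam (Z.erase e) y e) := by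
  have hq : 0 ≤ 1 - p e := sub_nonneg.2 (hp e).2.le
  rw [addProb_rcDist hp hlam, addProb_rcDist hp hlam]
  by_cases hef : e = f
  · subst hef
    rw [Finset.erase_insert_eq_erase, sub_self]
    exact ⟨le_rfl, mul_nonneg hq (add_nonneg (localInfluence_nonneg hlam _ _ _)
      (localInfluence_nonneg hlam _ _ _))⟩
  · rw [Finset.erase_insert_of_ne (Ne.symm hef)]
    have h := ratio_sub_ratio_insert hlam (Z.erase e) e f hf
    have h' := heatBath_sub (hp e).1 (hp e).2 (ratio_bounds hlam (insert f (Z.erase e)) e).1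
      (sub_nonneg.1 h.1)
    exact ⟨h'.1, h'.2.trans (mul_le_mul_of_nonneg_left h.2 hq)⟩

lemma addProb_mono (hp : ∀ e, 0 < p e ∧ p e < 1) (hlam : ∀ v, 0 ≤ lam v ∧ lam v < 1)
    (X Y : Finset G.edgeSet) (hYX : Y ⊆ X) (e : G.edgeSet) :
    addProb (rcDist G p lam) Y e ≤ addProb (rcDist G p lam) X e := by
  have key : ∀ F : Finset G.edgeSet,
      addProb (rcDist G p lam) Y e ≤ addProb (rcDist G p lam) (F ∪ Y) e := by
    intro F
    induction F using Finset.induction_on with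
    | empty => simp
    | insert f F _ ih =>
      obtain ⟨x, y, hf⟩ := exists_endpoints f
      rw [Finset.insert_union]
      linarith [(addProb_insert_sub hp hlam (F ∪ Y) e f hf).1]
  have h := key X
  rwa [Finset.union_eq_left.2 hYX] at h

lemma sum_addProb_insert_sub_le (hp : ∀ e, 0 < p e ∧ p e < 1)
    (hlam : ∀ v, 0 ≤ lam v ∧ lam v < 1) {q ρ ℓ : ℝ} (hq : ∀ e, 1 - p e ≤ q)
    (hρ : ∀ v, lam v ≤ ρ) (hρ1 : ρ < 1) (hℓ : 1 ≤ ℓ) (hqℓ : q * ℓ ≤ (1 - ρ) / 27)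
    (Z : Finset G.edgeSet) (f : G.edgeSet) (hZ : SmallCuts G ℓ Z) :
    ∑ e, (addProb (rcDist G p lam) (insert f Z) e - addProb (rcDist G p lam) Z e) ≤ 1 / 2 := by
  obtain ⟨x, y, hf⟩ := exists_endpoints f
  have hq0 : 0 ≤ q := by linarith [hq f, (hp f).2]
  have hle := add_le_add (sum_localInfluence_le hlam hρ hρ1 (zero_le_one.trans hℓ) hZ x)
    (sum_localInfluence_le hlam hρ hρ1 (zero_le_one.trans hℓ) hZ y)
  rw [← Finset.sum_add_distrib] at hle
  calc _ ≤ ∑ e, q * (localInfluence lam (Z.erase e) x e + localInfluence lam (Z.erase e) y e) := by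
        refine Finset.sum_le_sum fun e _ => (addProb_insert_sub hp hlam Z e f hf).2.trans ?_
        exact mul_le_mul_of_nonneg_right (hq e) (add_nonneg (localInfluence_nonneg hlam _ _ _)
          (localInfluence_nonneg hlam _ _ _))
    _ ≤ q * ((1 + ℓ) / (1 - ρ) + (1 + ℓ) / (1 - ρ)) := by
        rw [← Finset.mul_sum]
        exact mul_le_mul_of_nonneg_left hle hq0
    _ = 2 * (q * (1 + ℓ)) / (1 - ρ) := by ring
    _ ≤ 1 / 2 := by
        rw [div_le_iff₀ (by linarith)]
        -- Since `1 ≤ ℓ`, the numerator is at most `4 * q * ℓ ≤ 4 * (1 - ρ) / 27`.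
        nlinarith

/-- The factor `3q` is `2q / (2/3)`: the ratio is at most `2` and `p e ≥ 2/3`. -/
lemma weight_le_mul_weight_insert (hp : ∀ e, 0 < p e ∧ p e < 1)
    (hlam : ∀ v, 0 ≤ lam v ∧ lam v < 1) {q : ℝ} (hq : ∀ e, 1 - p e ≤ q) (hq3 : q ≤ 1 / 3)
    {S : Finset G.edgeSet} {e : G.edgeSet} (he : e ∉ S) :
    weight G p lam S ≤ 3 * q * weight G p lam (insert e S) := by
  have h := weight_mul_eq (p := p) hlam he
  have hr := ratio_bounds hlam S e
  have hw := weight_pos hp hlam (insert e S)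
  have hpe : 2 / 3 ≤ p e := by linarith [hq e]
  have h1 : (1 - p e) * ratio lam S e ≤ q * 2 :=
    mul_le_mul (hq e) hr.2 (by linarith) (by linarith [hq e, (hp e).2])
  have h2 : weight G p lam S * (2 / 3) ≤ weight G p lam (insert e S) * (q * 2) :=
    (mul_le_mul_of_nonneg_left hpe (weight_pos hp hlam S).le).trans
      (h.le.trans (mul_le_mul_of_nonneg_left h1 hw.le))
  linarith

lemma weight_le_pow_mul_weight_union (hp : ∀ e, 0 < p e ∧ p e < 1)
    (hlam : ∀ v, 0 ≤ lam v ∧ lam v < 1) {q : ℝ} (hq0 : 0 ≤ q) (hq : ∀ e, 1 - p e ≤ q)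
    (hq3 : q ≤ 1 / 3) (F : Finset G.edgeSet) {S : Finset G.edgeSet} (hFS : Disjoint F S) :
    weight G p lam S ≤ (3 * q) ^ F.card * weight G p lam (F ∪ S) := by
  induction F using Finset.induction_on with
  | empty => simp
  | insert f F hf ih =>
    rw [Finset.disjoint_insert_left] at hFS
    have h := weight_le_mul_weight_insert hp hlam hq hq3 (S := F ∪ S) (e := f)
      (by simp [hf, hFS.1])
    rw [Finset.card_insert_of_notMem hf, Finset.insert_union, pow_succ, mul_assoc]
    exact (ih hFS.2).trans (mul_le_mul_of_nonneg_left h (by positivity))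

/-- A Peierls argument: `S ↦ F ∪ S` is injective on configurations disjoint from `F` and gains a
factor `(3q)⁻¹` per added edge. -/
lemma sum_rcDist_disjoint_le (hp : ∀ e, 0 < p e ∧ p e < 1)
    (hlam : ∀ v, 0 ≤ lam v ∧ lam v < 1) {q : ℝ} (hq0 : 0 ≤ q) (hq : ∀ e, 1 - p e ≤ q)
    (hq3 : q ≤ 1 / 3) (F : Finset G.edgeSet) :
    ∑ S with Disjoint F S, rcDist G p lam S ≤ (3 * q) ^ F.card := by
  simp only [rcDist, ← Finset.sum_div]
  rw [div_le_iff₀ (sum_weight_pos hp hlam)]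
  calc _ ≤ ∑ S with Disjoint F S, (3 * q) ^ F.card * weight G p lam (F ∪ S) :=
        Finset.sum_le_sum fun S hS =>
          weight_le_pow_mul_weight_union hp hlam hq0 hq hq3 F (Finset.mem_filter.1 hS).2
    _ = (3 * q) ^ F.card *
          ∑ T ∈ (Finset.univ.filter (Disjoint F)).image (F ∪ ·), weight G p lam T := by
        rw [Finset.sum_image, Finset.mul_sum]
        intro S hS T hT h
        have hS' := (Finset.mem_filter.1 hS).2
        have hT' := (Finset.mem_filter.1 hT).2
        have h' : F ∪ S = F ∪ T := h
        rw [← Finset.union_sdiff_cancel_left hS', h', Finset.union_sdiff_cancel_left hT']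
    _ ≤ _ := by
        refine mul_le_mul_of_nonneg_left ?_ (by positivity)
        exact Finset.sum_le_sum_of_subset_of_nonneg (Finset.subset_univ _)
          fun S _ _ => (weight_pos hp hlam S).le

open Classical in
-- Union bound over the violating sets `A`: having more than `|A| * ℓ` boundary edges, each is cut
-- off with probability at most `θ ^ |A|`. Summing over all nonempty `A` is the binomial theorem.
lemma sum_rcDist_not_smallCuts_le (hp : ∀ e, 0 < p e ∧ p e < 1)
    (hlam : ∀ v, 0 ≤ lam v ∧ lam v < 1) {q : ℝ} (hq0 : 0 < q) (hq : ∀ e, 1 - p e ≤ q)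
    (hq3 : q ≤ 1 / 3) (ℓ : ℝ) :
    ∑ S with ¬ SmallCuts G ℓ S, rcDist G p lam S ≤
      (1 + (3 * q) ^ ℓ) ^ Fintype.card V - 1 := by
  set θ := (3 * q) ^ ℓ with hθ
  have hθ0 : 0 ≤ θ := Real.rpow_nonneg (by positivity) _
  set C : Finset (Finset V) := Finset.univ.filter fun A =>
    A.Nonempty ∧ (A.card : ℝ) * ℓ < (boundary G A).card with hC
  calc ∑ S with ¬ SmallCuts G ℓ S, rcDist G p lam S
      ≤ ∑ S, ∑ A ∈ C, if Disjoint (boundary G A) S then rcDist G p lam S else 0 := by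
        have hite : ∀ (A : Finset V) (S : Finset G.edgeSet),
            0 ≤ if Disjoint (boundary G A) S then rcDist G p lam S else 0 := fun A S => by
          split_ifs
          exacts [(rcDist_pos hp hlam S).le, le_rfl]
        rw [Finset.sum_filter]
        refine Finset.sum_le_sum fun S _ => ?_
        by_cases h : SmallCuts G ℓ S
        · rw [if_neg (not_not.2 h)]
          exact Finset.sum_nonneg fun A _ => hite A S
        · rw [if_pos h]
          unfold SmallCuts at h
          push Not at h
          obtain ⟨A, hA, hd, hlt⟩ := h
          refine le_trans ?_ (Finset.single_le_sum (fun A _ => hite A S)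
            (Finset.mem_filter.2 ⟨Finset.mem_univ A, hA, hlt⟩))
          rw [if_pos hd]
    _ = ∑ A ∈ C, ∑ S with Disjoint (boundary G A) S, rcDist G p lam S := by
        rw [Finset.sum_comm]
        simp only [Finset.sum_filter]
    _ ≤ ∑ A ∈ C, θ ^ A.card := by
        refine Finset.sum_le_sum fun A hA => ?_
        refine (sum_rcDist_disjoint_le hp hlam hq0.le hq hq3 _).trans ?_
        have hlt := (Finset.mem_filter.1 hA).2.2
        rw [hθ, ← Real.rpow_natCast, ← Real.rpow_natCast, ← Real.rpow_mul (by positivity),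
          mul_comm ℓ]
        exact Real.rpow_le_rpow_of_exponent_ge (by positivity) (by linarith) hlt.le
    _ ≤ ∑ A ∈ (Finset.univ : Finset (Finset V)).erase ∅, θ ^ A.card := by
        refine Finset.sum_le_sum_of_subset_of_nonneg (fun A hA => ?_) fun A _ _ => by positivity
        exact Finset.mem_erase.2 ⟨(Finset.mem_filter.1 hA).2.1.ne_empty, Finset.mem_univ _⟩
    _ = (1 + θ) ^ Fintype.card V - 1 := by
        have h := Finset.sum_erase_add Finset.univ (fun A : Finset V => θ ^ A.card)
          (Finset.mem_univ ∅)
        have h2 : ∑ A : Finset V, θ ^ A.card = (1 + θ) ^ Fintype.card V := by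
          rw [add_comm, ← Fintype.sum_pow_mul_eq_add_pow]
          simp
        rw [h2] at h
        simp only [Finset.card_empty, pow_zero] at h
        linarith

/-- Linearity of expectation over the missing edges. -/
lemma sum_rcDist_card_compl_le (hp : ∀ e, 0 < p e ∧ p e < 1)
    (hlam : ∀ v, 0 ≤ lam v ∧ lam v < 1) {q : ℝ} (hq0 : 0 ≤ q) (hq : ∀ e, 1 - p e ≤ q)
    (hq3 : q ≤ 1 / 3) :
    ∑ S, rcDist G p lam S * ((Finset.univ \ S).card : ℝ) ≤
      3 * q * Fintype.card G.edgeSet := by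
  calc ∑ S, rcDist G p lam S * ((Finset.univ \ S).card : ℝ)
      = ∑ S, ∑ e : G.edgeSet, if Disjoint {e} S then rcDist G p lam S else 0 := by
        refine Finset.sum_congr rfl fun S _ => ?_
        rw [← Finset.sum_filter, Finset.sum_const, nsmul_eq_mul, mul_comm]
        congr 3
        ext e; simp
    _ = ∑ e : G.edgeSet, ∑ S with Disjoint {e} S, rcDist G p lam S := by
        rw [Finset.sum_comm]
        simp only [Finset.sum_filter]
    _ ≤ ∑ _e : G.edgeSet, 3 * q := Finset.sum_le_sum fun e _ => by
        simpa using sum_rcDist_disjoint_le hp hlam hq0 hq hq3 {e}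
    _ = _ := by rw [Finset.sum_const, nsmul_eq_mul, Finset.card_univ, mul_comm]

end Model

/-! ### Numerical estimates. -/

section Numerics

lemma one_le_log {n : ℕ} (hn : 3 ≤ n) : 1 ≤ Real.log n := by
  rw [Real.le_log_iff_exp_le (by positivity)]
  have h : (3 : ℝ) ≤ n := by exact_mod_cast hn
  linarith [Real.exp_one_lt_d9]

/-- The constant enters through `3 * 10⁻⁵ ≤ exp (-5)`. Raised to the power `log n`, this gives
`n⁻⁵`, and the exponential factor of the hypothesis gives `ε / 8`. -/
lemma rpow_log_le {n : ℕ} (hn : 3 ≤ n) {q ε : ℝ} (hq : 0 ≤ q) (hε : 0 < ε)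
    (hlow : q * Real.log n ≤ (10 : ℝ) ^ (-5 : ℤ) * Real.exp (-(Real.log (8 / ε) / Real.log n))) :
    (3 * q) ^ Real.log n ≤ ε / 8 / (n : ℝ) ^ 5 := by
  have hℓ := one_le_log hn
  set ℓ := Real.log n with hℓdef
  have hn0 : (0 : ℝ) < n := by positivity
  have h5 : (3 : ℝ) * (10 : ℝ) ^ (-5 : ℤ) ≤ Real.exp (-5) := by
    have h1 : Real.exp 5 = Real.exp 1 ^ 5 := by rw [← Real.exp_nat_mul]; norm_num
    have h2 : Real.exp 5 ≤ 3 ^ 5 := by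
      rw [h1]
      exact pow_le_pow_left₀ (Real.exp_pos 1).le (by linarith [Real.exp_one_lt_d9]) 5
    rw [Real.exp_neg, le_inv_comm₀ (by positivity) (Real.exp_pos 5)]
    refine h2.trans ?_
    norm_num
  have hbase : 3 * q ≤ Real.exp (-5 - Real.log (8 / ε) / ℓ) := by
    have h1 : q ≤ q * ℓ := le_mul_of_one_le_right hq hℓ
    rw [sub_eq_add_neg, Real.exp_add]
    refine le_trans ?_ (mul_le_mul_of_nonneg_right h5 (Real.exp_pos _).le)
    linarith
  calc (3 * q) ^ ℓ ≤ Real.exp (-5 - Real.log (8 / ε) / ℓ) ^ ℓ :=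
        Real.rpow_le_rpow (by positivity) hbase (by linarith)
    _ = Real.exp (-(5 * ℓ) + -Real.log (8 / ε)) := by
        rw [← Real.exp_mul]
        congr 1
        field_simp
        ring
    _ = ε / 8 / (n : ℝ) ^ 5 := by
        rw [Real.exp_add, Real.exp_neg, Real.exp_neg, Real.exp_log (by positivity), hℓdef]
        have : Real.exp (5 * Real.log n) = (n : ℝ) ^ 5 := by
          rw [show (5 : ℝ) = ((5 : ℕ) : ℝ) by norm_num, Real.exp_nat_mul, Real.exp_log hn0]
        rw [this]
        field_simp

lemma bad_probability_le {n m : ℕ} (hn : 3 ≤ n) (hm : m ≤ n ^ 2) {θ ε : ℝ} (hθ : 0 ≤ θ)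
    (hε : 0 < ε ∧ ε < 1) (hle : θ ≤ ε / 8 / (n : ℝ) ^ 5) :
    2 * (m : ℝ) * ((1 + θ) ^ n - 1) ≤ ε / 4 := by
  have hn3 : (3 : ℝ) ≤ n := by exact_mod_cast hn
  have hm' : (m : ℝ) ≤ (n : ℝ) ^ 2 := by exact_mod_cast hm
  have hnθ : n * θ ≤ ε / 8 / (n : ℝ) ^ 4 := by
    calc n * θ ≤ n * (ε / 8 / (n : ℝ) ^ 5) := by gcongr
      _ = ε / 8 / (n : ℝ) ^ 4 := by field_simp
  have hn4 : ε / 8 / (n : ℝ) ^ 4 ≤ ε / 8 :=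
    div_le_self (by linarith) (one_le_pow₀ (by linarith))
  have h0 : 0 ≤ n * θ := by positivity
  have h1 : (1 + θ) ^ n - 1 ≤ 2 * (n * θ) := by
    have h2 : (1 + θ) ^ n ≤ Real.exp (n * θ) := by
      rw [Real.exp_nat_mul]
      exact pow_le_pow_left₀ (by linarith) (by linarith [Real.add_one_le_exp θ]) n
    have h3 := Real.abs_exp_sub_one_le (x := n * θ) (by rw [abs_of_nonneg h0]; linarith)
    rw [abs_of_nonneg h0] at h3
    linarith [le_abs_self (Real.exp (n * θ) - 1)]
  calc 2 * (m : ℝ) * ((1 + θ) ^ n - 1)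
      ≤ 2 * (n : ℝ) ^ 2 * (2 * (ε / 8 / (n : ℝ) ^ 4)) := by
        refine mul_le_mul (by linarith) (by linarith) ?_ (by positivity)
        linarith [one_le_pow₀ (show 1 ≤ 1 + θ by linarith) (n := n)]
    _ = ε / 2 / (n : ℝ) ^ 2 := by field_simp; ring
    _ ≤ ε / 4 := by
        rw [div_le_iff₀ (by positivity)]
        have h9 : (9 : ℝ) ≤ (n : ℝ) ^ 2 := by nlinarith
        nlinarith [mul_le_mul_of_nonneg_left h9 hε.1.le]

/-- The slack `-1` accommodates rounding the time down to an integer; it costs `exp (1 / (2m)) ≤ exp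
1 ≤ 3`. -/
lemma contraction_pow_le {m t : ℕ} (hm : 1 ≤ m) {ε : ℝ} (hε : 0 < ε)
    (ht : 2 * (m : ℝ) * (Real.log m + Real.log (2 / ε)) - 1 ≤ t) :
    (1 - 1 / (2 * (m : ℝ))) ^ t ≤ 3 * (ε / (2 * m)) := by
  have hm1 : (1 : ℝ) ≤ m := by exact_mod_cast hm
  have hm0 : (0 : ℝ) < m := by linarith
  have hinv : 1 / (2 * (m : ℝ)) ≤ 1 := by
    rw [div_le_one (by positivity)]; linarith
  calc (1 - 1 / (2 * (m : ℝ))) ^ t ≤ Real.exp (-(1 / (2 * (m : ℝ)))) ^ t :=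
        pow_le_pow_left₀ (by linarith) (Real.one_sub_le_exp_neg _) t
    _ = Real.exp (-(t / (2 * (m : ℝ)))) := by
        rw [← Real.exp_nat_mul]; congr 1; ring
    _ ≤ Real.exp (1 + -(Real.log m + Real.log (2 / ε))) := by
        refine Real.exp_le_exp.2 ?_
        have h : (2 * (m : ℝ) * (Real.log m + Real.log (2 / ε)) - 1) / (2 * m) ≤ t / (2 * m) := by
          gcongr
        have h2 : (2 * (m : ℝ) * (Real.log m + Real.log (2 / ε)) - 1) / (2 * m) =
            (Real.log m + Real.log (2 / ε)) - 1 / (2 * m) := by field_simp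
        linarith
    _ = Real.exp 1 * (ε / (2 * m)) := by
        rw [Real.exp_add, Real.exp_neg, Real.exp_add, Real.exp_log hm0,
          Real.exp_log (by positivity)]
        congr 1
        field_simp
    _ ≤ 3 * (ε / (2 * m)) := by
        gcongr
        linarith [Real.exp_one_lt_d9]

end Numerics

/-! ### Assembling the discrepancy bound and the coupling. -/

section MainBound

variable {V : Type u} [Fintype V] [DecidableEq V] {G : SimpleGraph V} [DecidableRel G.Adj]

/-- The initial discrepancy is at most `m/8` and contracts to `3ε/16`; the bad configurations add at
most `ε/4`. -/
theorem expected_disc_lt (p : G.edgeSet → ℝ) (lam : V → ℝ) (ε : ℝ)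
    (hn : 3 ≤ Fintype.card V) [Nonempty G.edgeSet]
    (hp : ∀ e, 0 < p e ∧ p e < 1) (hlam : ∀ v, 0 ≤ lam v ∧ lam v < 1)
    (hε : 0 < ε ∧ ε < 1)
    (hlow : (1 - ⨅ e, p e) * Real.log (Fintype.card V) ≤
      min ((10 : ℝ) ^ (-5 : ℤ) * Real.exp (-(Real.log (8 / ε) / Real.log (Fintype.card V))))
        ((1 - ⨆ v, lam v) / 27))
    (t : ℕ) (ht : 2 * (Fintype.card G.edgeSet : ℝ) *
      (Real.log (Fintype.card G.edgeSet) + Real.log (2 / ε)) - 1 ≤ t) :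
    ∑ z, coupledLaw (rcDist G p lam) t z * ((z.1 \ z.2).card : ℝ) < ε := by
  classical
  have hV : Nonempty V := Fintype.card_pos_iff.1 (by omega)
  set q := 1 - ⨅ e, p e with hq
  set ρ := ⨆ v, lam v with hρ
  set ℓ := Real.log (Fintype.card V) with hℓdef
  set m := Fintype.card G.edgeSet with hm
  have hℓ : 1 ≤ ℓ := one_le_log hn
  have hqe : ∀ e, 1 - p e ≤ q := fun e =>
    sub_le_sub_left (ciInf_le (Set.finite_range p).bddBelow e) 1
  have hρv : ∀ v, lam v ≤ ρ := fun v => le_ciSup (Set.finite_range lam).bddAbove v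
  have hq0 : 0 < q := by
    obtain ⟨e⟩ := ‹Nonempty G.edgeSet›
    linarith [hqe e, (hp e).2]
  have hρ1 : ρ < 1 := by
    obtain ⟨v, hv⟩ := exists_eq_ciSup_of_finite (f := lam)
    rw [hρ, ← hv]
    exact (hlam v).2
  obtain ⟨hlow1, hlow2⟩ := le_min_iff.1 hlow
  have hq8 : 3 * q ≤ 1 / 8 := by
    have h1 : q ≤ q * ℓ := le_mul_of_one_le_right hq0.le hℓ
    have h2 : Real.exp (-(Real.log (8 / ε) / ℓ)) ≤ 1 := by
      refine Real.exp_le_one_iff.2 (neg_nonpos.2 (div_nonneg (Real.log_nonneg ?_) (by linarith)))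
      rw [le_div_iff₀ hε.1]; linarith
    have h3 : (10 : ℝ) ^ (-5 : ℤ) * Real.exp (-(Real.log (8 / ε) / ℓ)) ≤ (10 : ℝ) ^ (-5 : ℤ) :=
      mul_le_of_le_one_right (by positivity) h2
    have h4 : (10 : ℝ) ^ (-5 : ℤ) ≤ 1 / 24 := by norm_num
    linarith
  have hm1 : 1 ≤ m := Fintype.card_pos
  have hmn : m ≤ Fintype.card V ^ 2 := by
    have h := G.card_edgeFinset_le_card_choose_two
    rw [SimpleGraph.edgeFinset_card] at h
    exact h.trans (Nat.choose_le_pow _ _)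
  have hbound := expected_disc_le (rcDist_pos hp hlam) (addProb_mono hp hlam)
    (Good := SmallCuts G ℓ) (fun X Y h => SmallCuts.mono h)
    (fun Z f hZ _ => sum_addProb_insert_sub_le hp hlam hqe hρv hρ1 hℓ hlow2 Z f hZ) t
  have hinit := sum_rcDist_card_compl_le hp hlam hq0.le hqe (by linarith)
  have hbad := sum_rcDist_not_smallCuts_le hp hlam hq0 hqe (by linarith) ℓ
  have hθ := rpow_log_le hn hq0.le hε.1 hlow1
  have hbad' := bad_probability_le hn hmn (Real.rpow_nonneg (by positivity) _) hε hθ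
  have hpow := contraction_pow_le hm1 hε.1 ht
  rw [← hm] at hinit hbound
  have hmr : (1 : ℝ) ≤ m := by exact_mod_cast hm1
  have h1 : (1 - 1 / (2 * (m : ℝ))) ^ t *
      ∑ S, rcDist G p lam S * ((Finset.univ \ S).card : ℝ) ≤
      3 * (ε / (2 * m)) * (1 / 8 * m) := by
    refine mul_le_mul hpow (hinit.trans (mul_le_mul_of_nonneg_right hq8 (by linarith))) ?_ ?_
    · exact Finset.sum_nonneg fun S _ => mul_nonneg (rcDist_pos hp hlam S).le (Nat.cast_nonneg _)
    · have := hε.1; positivity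
  have h2 : 3 * (ε / (2 * m)) * (1 / 8 * m) = 3 / 16 * ε := by field_simp; ring
  have h3 := mul_le_mul_of_nonneg_left hbad (show 0 ≤ 2 * (m : ℝ) by linarith)
  linarith [hε.1]

lemma sum_filter_fst {α β : Type*} [Fintype α] [Fintype β] [DecidableEq α] (g : α × β → ℝ) (a : α) :
    ∑ z with z.1 = a, g z = ∑ b, g (a, b) := by
  rw [Finset.sum_filter, Fintype.sum_prod_type, Finset.sum_eq_single a]
  · simp
  · intro b _ hb; simp [hb]
  · simp

lemma sum_filter_snd {α β : Type*} [Fintype α] [Fintype β] [DecidableEq β] (g : α × β → ℝ) (b : β) :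
    ∑ z with z.2 = b, g z = ∑ a, g (a, b) := by
  rw [Finset.sum_filter, Fintype.sum_prod_type_right, Finset.sum_eq_single b]
  · simp
  · intro a _ ha; simp [ha]
  · simp

/-- The chain of pairs is built first; each coordinate is then a Glauber chain because `coupled` is
lumpable along both projections. -/
theorem exists_coupling {U : Type u} [Fintype U] [DecidableEq U] [Nonempty U]
    {μ : Finset U → ℝ} (hμ : ∀ S, 0 < μ S) (hsum : ∑ S, μ S = 1) :
    ∃ (S : Type u) (_ : MeasurableSpace S) (ℙ : Measure S) (_ : IsProbabilityMeasure ℙ)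
      (X Y : ℕ → S → Finset U),
      IsMarkovChain ℙ (fun A => if A = Finset.univ then 1 else 0) (glauber μ) X ∧
      IsMarkovChain ℙ μ (glauber μ) Y ∧
      ∀ T, ℙ {s | X T s ≠ Y T s} =
        ENNReal.ofReal (∑ z with z.1 ≠ z.2, coupledLaw μ T z) := by
  set ν : Finset U × Finset U → ℝ := fun z => (if z.1 = Finset.univ then 1 else 0) * μ z.2 with hν
  have hν0 : ∀ z, 0 ≤ ν z := fun z => mul_nonneg (by split_ifs <;> norm_num) (hμ _).le
  have hν1 : ∀ X, ∑ Y, ν (X, Y) = if X = Finset.univ then 1 else 0 := fun X => by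
    refine (Finset.mul_sum Finset.univ μ (if X = Finset.univ then (1 : ℝ) else 0)).symm.trans ?_
    rw [hsum, mul_one]
  have hν2 : ∀ Y, ∑ X, ν (X, Y) = μ Y := fun Y => by simp [hν]
  obtain ⟨S, mS, ℙ, hℙ, Z, hZ⟩ := exists_markovChain (ν := ν) hν0
    (by rw [Fintype.sum_prod_type_right]; simp only [hν2, hsum]) (K := coupled μ)
    (coupled_nonneg hμ) (coupled_row_sum hμ)
  refine ⟨S, mS, ℙ, hℙ, fun t s => (Z t s).1, fun t s => (Z t s).2, ?_, ?_, fun T => ?_⟩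
  · exact hZ.lump hν0 (coupled_nonneg hμ) Prod.fst
      (fun X => (sum_filter_fst ν X).trans (hν1 X))
      fun z X => (sum_filter_fst _ X).trans (sum_coupled_fst hμ z X)
  · exact hZ.lump hν0 (coupled_nonneg hμ) Prod.snd
      (fun Y => (sum_filter_snd ν Y).trans (hν2 Y))
      fun z Y => (sum_filter_snd _ Y).trans (sum_coupled_snd hμ z Y)
  · have h := measure_mem_eq hν0 (coupled_nonneg hμ) hZ T
      (Finset.univ.filter fun z : Finset U × Finset U => z.1 ≠ z.2)
    simp only [Finset.mem_filter, Finset.mem_univ, true_and] at h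
    exact h

end MainBound

end RandomCluster

end

theorem mainTheorem6 {V : Type u} [Fintype V] [DecidableEq V]
    (G : SimpleGraph V) [DecidableRel G.Adj]
    (p : G.edgeSet → ℝ) (lam : V → ℝ) (ε : ℝ)
    (hn : 3 ≤ Fintype.card V) (hE : G.edgeSet.Nonempty)
    (hp : ∀ e, 0 < p e ∧ p e < 1) (hlam : ∀ v, 0 ≤ lam v ∧ lam v < 1)
    (hε : 0 < ε ∧ ε < 1)
    (hlow : (1 - ⨅ e, p e) * Real.log (Fintype.card V) ≤
      min ((10 : ℝ) ^ (-5 : ℤ) * Real.exp (-(Real.log (8 / ε) / Real.log (Fintype.card V))))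
        ((1 - ⨆ v, lam v) / 27)) :
    (∃ T : ℕ,
      RandomCluster.IsMixingTime (RandomCluster.glauber (RandomCluster.rcDist G p lam))
        (RandomCluster.rcDist G p lam) ε Finset.univ T ∧
      (T : ℝ) ≤ 2 * (G.edgeFinset.card : ℝ) *
        (Real.log (G.edgeFinset.card : ℝ) + Real.log (2 / ε))) ∧
    (∀ T : ℕ,
      2 * (G.edgeFinset.card : ℝ) *
        (Real.log (G.edgeFinset.card : ℝ) + Real.log (2 / ε)) ≤ (T : ℝ) →
      ∃ (S : Type u) (_ : MeasurableSpace S) (ℙ : Measure S) (_ : IsProbabilityMeasure ℙ)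
        (X Y : ℕ → S → Finset G.edgeSet),
        RandomCluster.IsMarkovChain ℙ (fun A => if A = Finset.univ then 1 else 0)
          (RandomCluster.glauber (RandomCluster.rcDist G p lam)) X ∧
        RandomCluster.IsMarkovChain ℙ (RandomCluster.rcDist G p lam)
          (RandomCluster.glauber (RandomCluster.rcDist G p lam)) Y ∧
        ℙ {s | X T s ≠ Y T s} ≤ ENNReal.ofReal ε) := by
  have hne : Nonempty G.edgeSet := hE.to_subtype
  have hμ := RandomCluster.rcDist_pos (G := G) hp hlam
  have hsum := RandomCluster.sum_rcDist (G := G) hp hlam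
  have hdisc := RandomCluster.expected_disc_lt p lam ε hn hp hlam hε hlow
  have hne_le := RandomCluster.sum_coupledLaw_ne_le hμ (RandomCluster.addProb_mono hp hlam)
  rw [SimpleGraph.edgeFinset_card]
  constructor
  · set x := 2 * (Fintype.card G.edgeSet : ℝ) *
      (Real.log (Fintype.card G.edgeSet : ℝ) + Real.log (2 / ε)) with hx
    have hm : (1 : ℝ) ≤ Fintype.card G.edgeSet := by exact_mod_cast Fintype.card_pos
    have hx0 : 0 ≤ x := by
      refine mul_nonneg (by linarith) (add_nonneg (Real.log_nonneg hm) (Real.log_nonneg ?_))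
      rw [le_div_iff₀ hε.1]
      linarith [hε.2]
    have hmix : RandomCluster.tvDist (fun Y =>
        (RandomCluster.glauber (RandomCluster.rcDist G p lam) ^ ⌊x⌋₊) Finset.univ Y)
        (RandomCluster.rcDist G p lam) < ε :=
      ((RandomCluster.tvDist_le_sum_coupledLaw hμ hsum _).trans (hne_le _)).trans_lt
        -- The integer `T` must not exceed the real bound `x`, so the estimate is applied at its
        -- floor, which is more than `x - 1`.
        (hdisc _ (by linarith [Nat.lt_floor_add_one x]))
    have hex : ∃ t, RandomCluster.tvDist (fun Y =>
        (RandomCluster.glauber (RandomCluster.rcDist G p lam) ^ t) Finset.univ Y)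
        (RandomCluster.rcDist G p lam) < ε := ⟨_, hmix⟩
    classical
    refine ⟨Nat.find hex, ⟨Nat.find_spec hex, fun t ht => Nat.find_min' hex ht⟩, ?_⟩
    exact (Nat.cast_le.2 (Nat.find_min' hex hmix)).trans (Nat.floor_le hx0)
  · intro T hT
    obtain ⟨S, mS, ℙ, hℙ, X, Y, hX, hY, hXY⟩ := RandomCluster.exists_coupling hμ hsum
    refine ⟨S, mS, ℙ, hℙ, X, Y, hX, hY, ?_⟩
    rw [hXY]
    exact ENNReal.ofReal_le_ofReal ((hne_le T).trans (hdisc T (by linarith)).le)
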